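/- **Setting.** $m\ge1$ agents control copies of one system $x_{i,t+1}=Ax_{i,t}+Bu_{i,t}+w_t$, $x_{i,1}=0$, with $x\in\mathbb R^{d_1}$, $u\in\mathbb R^{d_2}$, $d_2\ge 1$, $d=\max\{d_1,d_2\}$; $\|\cdot\|$ is the Euclidean/spectral norm. Constants $\kappa,W,G_c>1$ and $\gamma\in(0,1]$ are given, and it is assumed that: (1) $\|A\|,\|B\|\le\kappa$ and $\|w_t\|\le W$ for all $t$ ($w$ is otherwise arbitrary); (2) each cost $c_{i,t}(x,u)$ is convex and differentiable, and $\|\nabla c_{i,t}(x,u)\|\le G_cD'$ whenever $\|x\|,\|u\|\le D'$; (3) $K$ is $(\kappa,\gamma)$-strongly stable for $(A,B)$: $\|K\|\le\kappa$ and $A-BK=QLQ^{-1}$ with $\|L\|\le1-\gamma$, $\|Q\|,\|Q^{-1}\|\le\kappa$; (4) $(A-BK,B)$ is $(q,\kappa)$-strongly controllable, $q\ge1$: for $C_q=[B,(A-BK)B,\dots,(A-BK)^{q-1}B]$ the matrix $C_qC_q^\top$ is invertible and $\|(C_qC_q^\top)^{-1}\|\le\kappa$. $P\in\mathbb R^{m\times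 m}$ is symmetric, doubly stochastic, with positive diagonal and connected graph; $\beta$ is its second largest singular value ($0$ if $m=1$). **Surrogate costs.** Let $H\ge1$ and $M=(M^{[0]},\dots,M^{[H-1]})$ with $M^{[k]}\in\mathbb R^{d_2\times d_1}$. For a system $(A',B')$, a sequence $w'$ and policies $(M_s)_s$ put $$\Psi_{t,i}=(A'-B'K)^i\mathbf 1_{i\le H}+\sum_{j=0}^{H}(A'-B'K)^jB'M_{t-j}^{[i-j-1]}\mathbf 1_{i-j\in[1,H]},$$ $$y_t=\sum_{i=0}^{2H}\Psi_{t-1,i}w'_{t-1-i},\qquad v_t=-Ky_t+\sum_{k=1}^HM_t^{[k-1]}w'_{t-k},$$ and $f_{i,t}(M_{t-H-1:t}\mid A',B',\{w'\})=c_{i,t}(y_t,v_t)$; write $f_{i,t}(M\mid\cdot)$ if all $M_s=M$. **Algorithm.** Let $\mathcal M=\{M:\|M^{[k]}\|\le2\kappa^3(1-\gamma)^k,\ 0\le k<H\}$, $T_{collect}>q+1$, $T_0=T_{collect}+T_{exchange}$, $\eta>0$. *Exploration*, $1\le t\le T_0$: $u_{i,t}=-Kx_{i,t}+\xi_{i,t}$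 with $\xi_{i,t}\in\{\pm1\}^{d_2}$ random. With $N_{i,k}=\frac1{T_{collect}-(q+1)}\sum_{t=1}^{T_{collect}-(q+1)}x_{i,t+k+1}\xi_{i,t}^\top$, $0\le k\le q$, the agents perform $T_{exchange}$ rounds of $N_{i,k}\leftarrow\sum_jP_{ji}N_{j,k}$ and set $\widehat B_i=N_{i,0}$, $\widehat A_i=C_{i,1}C_{i,0}^\top(C_{i,0}C_{i,0}^\top)^{-1}+\widehat B_iK$, where $C_{i,0}=[N_{i,0},\dots,N_{i,q-1}]$ and $C_{i,1}=[N_{i,1},\dots,N_{i,q}]$. *Learning*, $T_0<t\le T$: all agents start from the same $M_{i,T_0+1}\in\mathcal M$; $\hat w_{i,s}=0$ for $s\le T_0$; $$u_{i,t}=-Kx_{i,t}+\sum_{k=1}^HM_{i,t}^{[k-1]}\hat w_{i,t-k},\qquad \hat w_{i,t}=x_{i,t+1}-\widehat A_ix_{i,t}-\widehat B_iu_{i,t},$$ $$M_{i,t+1}=\Pi_{\mathcal M}\Big[\sum_jP_{ji}M_{j,t}-\eta\nabla f_{i,t}(M_{i,t}\mid\widehat A_i,\widehat B_i,\{\hat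 w_i\})\Big]\quad\text{(Frobenius projection and gradient).}$$ **Theorem.** There is a universal constant $C_1>0$, and for all $m,d_1,d_2,\kappa,\gamma$ as above a constant $C_2>0$ depending only on these five, such that the following holds for every run of the algorithm and every realization of $\xi$. Let $0<\epsilon\le\frac{\gamma^2}{12\kappa^7}$ and $\epsilon'$ be such that, for all agents $i,l$, $\|A-\widehat A_i\|,\|B-\widehat B_i\|\le\epsilon$ and $\|\widehat A_i-\widehat A_l\|,\|\widehat B_i-\widehat B_l\|\le\epsilon'$, and let $\kappa^2(1-\gamma+2\kappa^3\epsilon)^{H+1}<1$. Put $\zeta=\frac{24W\sqrt{d_2}\kappa^7}{\gamma^2}$, $W'=W+\zeta\epsilon$, $\gamma'=\gamma-2\kappa^3\epsilon$, $S=\frac{\kappa^3(\kappa+\epsilon)W'}{\gamma'}+W'$ and $$D=\frac{W'(\kappa^2+2H(\kappa+\epsilon)\kappa^5)}{\gamma'(1-\kappa^2(1-\gamma')^{H+1})}+\frac{2W'\kappa^3}{\gamma}.$$ Then for every agent $j$ and every $M^*\in\mathcal M$ $$\sum_{t=T_0+1}^T\sum_{i=1}^m\Big[f_{i,t}(M_{j,t-H-1:t}\mid\widehat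 A_j,\widehat B_j,\{\hat w_j\})-f_{i,t}(M^*\mid\widehat A_i,\widehat B_i,\{\hat w_i\})\Big]\le C_1\kappa^2\,(E_1+E_2+E_3+E_4+E_5)+\frac{C_2}{\eta},$$ where $$E_1=\eta TmH^3(G_cD)^2(\kappa+\epsilon)\kappa^3W'\frac{S\sqrt m}{1-\beta},\qquad E_3=\eta Tm\sqrt m\,G_cDd^3H\frac{S^2}{1-\beta},$$ $$E_2=mTG_cD\sqrt2\Big[\kappa\Big(\frac{2\kappa^5\epsilon'W'}{\gamma'^2}+\frac{4\kappa^8H^2(\kappa+\epsilon)\epsilon'W'}{(1-\gamma')\gamma'}+\frac{(H+1)2\kappa^5\epsilon'W'}{(1-\gamma')\gamma'}+\frac{\kappa^2+H(\kappa+\epsilon)2\kappa^5}{\gamma'}\,2\zeta\epsilon\Big)+\frac{4\kappa^3\zeta\epsilon}{\gamma}\Big],$$ $$E_4=\eta Tm\big(G_cDd\sqrt d\sqrt H\,S\big)^2,\qquad E_5=\frac1\eta Tm\Big(\frac{\eta G_cDd\sqrt d\sqrt H\,S\sqrt m}{1-\beta}\Big)^2.$$ -/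

import Mathlib

open scoped Matrix.Norms.L2Operator

noncomputable section

namespace DistributedControl

/-! Throughout, `‖·‖` of a matrix is the spectral norm (the `L2Operator` norm), vectors live in
`EuclideanSpace`, and time is integer valued, so that "time `≤ 0`" makes sense. -/

/-- The space `ℝᵈ` with the Euclidean norm. -/
abbrev Vec (d : ℕ) := EuclideanSpace ℝ (Fin d)

/-- State-action pairs `(x, u)` with the Euclidean norm of the concatenated vector. -/
abbrev StateAction (d₁ d₂ : ℕ) := WithLp 2 (Vec d₁ × Vec d₂)

/-- Policy parameters `M = (M^[0], …, M^[H-1])` with `M^[k] ∈ ℝ^{d₂ × d₁}`; the norm of this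
Euclidean space is the Frobenius norm of the tuple. -/
abbrev Param (H d₁ d₂ : ℕ) := EuclideanSpace ℝ (Fin H × Fin d₂ × Fin d₁)

/-- The matrix `M^[k]`. -/
def block {H d₁ d₂ : ℕ} (M : Param H d₁ d₂) (k : Fin H) : Matrix (Fin d₂) (Fin d₁) ℝ :=
  Matrix.of fun a b => M (k, a, b)

/-- The matrix-vector product on Euclidean spaces. -/
def act {n d : ℕ} (A : Matrix (Fin n) (Fin d) ℝ) (x : Vec d) : Vec n :=
  WithLp.toLp 2 (A.mulVec x.ofLp)

/-! ### Strong stability, strong controllability, network, costs -/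

/-- `K` is `(κ, γ)`-strongly stable for the system `(A, B)`. -/
def StronglyStable {d₁ d₂ : ℕ} (κ γ : ℝ) (A : Matrix (Fin d₁) (Fin d₁) ℝ)
    (B : Matrix (Fin d₁) (Fin d₂) ℝ) (K : Matrix (Fin d₂) (Fin d₁) ℝ) : Prop :=
  0 < κ ∧ 0 < γ ∧ γ ≤ 1 ∧ ‖K‖ ≤ κ ∧
    ∃ L Q : Matrix (Fin d₁) (Fin d₁) ℝ, IsUnit Q.det ∧ A - B * K = Q * L * Q⁻¹ ∧
      ‖L‖ ≤ 1 - γ ∧ ‖Q‖ ≤ κ ∧ ‖Q⁻¹‖ ≤ κ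

/-- The block matrix `C_q = [B, AB, …, A^{q-1}B]`. -/
def controllabilityMatrix {d₁ d₂ : ℕ} (q : ℕ) (A : Matrix (Fin d₁) (Fin d₁) ℝ)
    (B : Matrix (Fin d₁) (Fin d₂) ℝ) : Matrix (Fin d₁) (Fin q × Fin d₂) ℝ :=
  Matrix.of fun a kb => (A ^ (kb.1 : ℕ) * B) a kb.2

/-- `(A, B)` is `(q, κ)`-strongly controllable: `C_q` has full row rank, i.e. `C_q C_qᵀ` is
invertible, and the inverse has norm at most `κ`. -/
def StronglyControllable {d₁ d₂ : ℕ} (q : ℕ) (κ : ℝ) (A : Matrix (Fin d₁) (Fin d₁) ℝ)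
    (B : Matrix (Fin d₁) (Fin d₂) ℝ) : Prop :=
  1 ≤ q ∧
    IsUnit (controllabilityMatrix q A B * (controllabilityMatrix q A B).transpose).det ∧
    ‖(controllabilityMatrix q A B * (controllabilityMatrix q A B).transpose)⁻¹‖ ≤ κ

/-- `P` is a symmetric doubly stochastic matrix with positive diagonal, and the undirected graph
of its positive entries is connected. -/
def IsNetworkMatrix {m : ℕ} (P : Matrix (Fin m) (Fin m) ℝ) : Prop :=
  P.IsSymm ∧ P ∈ doublyStochastic ℝ (Fin m) ∧ (∀ i, 0 < P i i) ∧
    (SimpleGraph.fromRel fun i j => 0 < P i j).Connected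

/-- The second largest singular value of `P` (singular values are listed in decreasing order
from index `0`; the value is `0` for a `1 × 1` matrix). -/
def secondSingularValue {m : ℕ} (P : Matrix (Fin m) (Fin m) ℝ) : ℝ :=
  (Matrix.toEuclideanLin P).singularValues 1

/-- The cost is convex and differentiable, and its gradient at `(x, u)` has norm at most `Gc * D`
as soon as `‖x‖, ‖u‖ ≤ D`. -/
def CostAssumption {d₁ d₂ : ℕ} (Gc : ℝ) (c : StateAction d₁ d₂ → ℝ) : Prop :=
  ConvexOn ℝ Set.univ c ∧ Differentiable ℝ c ∧
    ∀ (D : ℝ) (z : StateAction d₁ d₂), ‖z.fst‖ ≤ D → ‖z.snd‖ ≤ D → ‖gradient c z‖ ≤ Gc * D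

/-! ### Disturbance feedback policies and surrogate costs -/

/-- The disturbance-state transfer matrix `Ψ^{K,h}_{t,i}(M_{t-h:t} | A, B)`. The indicator of
`i - j ∈ [1, H]` together with the index `i - j - 1` of the block is expressed by summing over
the blocks `k ∈ {0, …, H-1}` with `i = j + k + 1`. -/
def transferMatrix {H d₁ d₂ : ℕ} (A : Matrix (Fin d₁) (Fin d₁) ℝ)
    (B : Matrix (Fin d₁) (Fin d₂) ℝ) (K : Matrix (Fin d₂) (Fin d₁) ℝ) (h : ℕ)
    (M : ℤ → Param H d₁ d₂) (t : ℤ) (i : ℕ) : Matrix (Fin d₁) (Fin d₁) ℝ :=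
  (if i ≤ h then (A - B * K) ^ i else 0) +
    ∑ j ∈ Finset.range (h + 1), ∑ k : Fin H,
      if i = j + (k : ℕ) + 1 then (A - B * K) ^ j * B * block (M (t - (j : ℤ))) k else 0

/-- The surrogate state at time `t`:
`y_t = ∑_{i=0}^{2H} Ψ^{K,H}_{t-1,i}(M_{t-1-H:t-1} | A, B) w_{t-1-i}`. -/
def surrogateState {H d₁ d₂ : ℕ} (A : Matrix (Fin d₁) (Fin d₁) ℝ)
    (B : Matrix (Fin d₁) (Fin d₂) ℝ) (K : Matrix (Fin d₂) (Fin d₁) ℝ)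
    (w : ℤ → Vec d₁) (M : ℤ → Param H d₁ d₂) (t : ℤ) : Vec d₁ :=
  ∑ i ∈ Finset.range (2 * H + 1),
    act (transferMatrix A B K H M (t - 1) i) (w (t - 1 - (i : ℤ)))

/-- The surrogate action at time `t`: `v_t = -K y_t + ∑_{k=1}^{H} M_t^[k-1] w_{t-k}`. -/
def surrogateAction {H d₁ d₂ : ℕ} (A : Matrix (Fin d₁) (Fin d₁) ℝ)
    (B : Matrix (Fin d₁) (Fin d₂) ℝ) (K : Matrix (Fin d₂) (Fin d₁) ℝ)
    (w : ℤ → Vec d₁) (M : ℤ → Param H d₁ d₂) (t : ℤ) : Vec d₂ :=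
  -act K (surrogateState A B K w M t) +
    ∑ k : Fin H, act (block (M t) k) (w (t - 1 - ((k : ℕ) : ℤ)))

/-- The surrogate cost at time `t`, `c(y_t, v_t)`; it depends on the policy sequence `M` only
through `M_{t-H-1}, …, M_t`. For a time-invariant policy take `M` constant. -/
def surrogateCost {H d₁ d₂ : ℕ} (c : StateAction d₁ d₂ → ℝ) (A : Matrix (Fin d₁) (Fin d₁) ℝ)
    (B : Matrix (Fin d₁) (Fin d₂) ℝ) (K : Matrix (Fin d₂) (Fin d₁) ℝ)
    (w : ℤ → Vec d₁) (t : ℤ) (M : ℤ → Param H d₁ d₂) : ℝ :=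
  c (WithLp.toLp 2 (surrogateState A B K w M t, surrogateAction A B K w M t))

/-- The feasible set `{M : ‖M^[k]‖ ≤ 2κ³(1-γ)^k, k = 0, …, H-1}`. -/
def policySet (H d₁ d₂ : ℕ) (κ γ : ℝ) : Set (Param H d₁ d₂) :=
  {M | ∀ k : Fin H, ‖block M k‖ ≤ 2 * κ ^ 3 * (1 - γ) ^ (k : ℕ)}

/-- `y` is the Euclidean projection of `x` on the set `S`. -/
def IsProjection {E : Type*} [NormedAddCommGroup E] (S : Set E) (x y : E) : Prop :=
  y ∈ S ∧ ∀ z ∈ S, ‖x - y‖ ≤ ‖x - z‖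

/-! ### Distributed system identification -/

/-- The moment `N_{i,k}` of an agent with states `x` and excitations `ξ`, after `Tc` collection
steps: `(Tc - (q+1))⁻¹ ∑_{t=1}^{Tc-(q+1)} x_{t+k+1} ξ_tᵀ`. -/
def moment {d₁ d₂ : ℕ} (q Tc : ℕ) (x : ℤ → Vec d₁) (ξ : ℤ → Vec d₂) (k : ℕ) :
    Matrix (Fin d₁) (Fin d₂) ℝ :=
  ((Tc : ℝ) - ((q : ℝ) + 1))⁻¹ •
    ∑ t ∈ Finset.Icc (1 : ℤ) ((Tc : ℤ) - ((q : ℤ) + 1)),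
      Matrix.vecMulVec (x (t + (k : ℤ) + 1)).ofLp (ξ t).ofLp

/-- Agent `i`'s matrix after `s` rounds of averaging `N_i ← ∑_j P_{ji} N_j`. -/
def exchange {m d₁ d₂ : ℕ} (P : Matrix (Fin m) (Fin m) ℝ)
    (N : Fin m → Matrix (Fin d₁) (Fin d₂) ℝ) : ℕ → Fin m → Matrix (Fin d₁) (Fin d₂) ℝ
  | 0, i => N i
  | s + 1, i => ∑ j, P j i • exchange P N s j

/-- The matrix `N^{T₀}_{i,k}`: `Te` rounds of averaging applied to the collected moments. -/
def finalMoment {m d₁ d₂ : ℕ} (P : Matrix (Fin m) (Fin m) ℝ) (q Tc Te : ℕ)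
    (x : Fin m → ℤ → Vec d₁) (ξ : Fin m → ℤ → Vec d₂) (i : Fin m) (k : ℕ) :
    Matrix (Fin d₁) (Fin d₂) ℝ :=
  exchange P (fun j => moment q Tc (x j) (ξ j) k) Te i

/-- The block matrix `[N^{T₀}_{i,s}, …, N^{T₀}_{i,s+q-1}]`. -/
def momentBlocks {m d₁ d₂ : ℕ} (P : Matrix (Fin m) (Fin m) ℝ) (q Tc Te : ℕ)
    (x : Fin m → ℤ → Vec d₁) (ξ : Fin m → ℤ → Vec d₂) (i : Fin m) (s : ℕ) :
    Matrix (Fin d₁) (Fin q × Fin d₂) ℝ :=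
  Matrix.of fun a kb => finalMoment P q Tc Te x ξ i (s + (kb.1 : ℕ)) a kb.2

/-- Agent `i`'s estimate of `B`. -/
def estB {m d₁ d₂ : ℕ} (P : Matrix (Fin m) (Fin m) ℝ) (q Tc Te : ℕ)
    (x : Fin m → ℤ → Vec d₁) (ξ : Fin m → ℤ → Vec d₂) (i : Fin m) :
    Matrix (Fin d₁) (Fin d₂) ℝ :=
  finalMoment P q Tc Te x ξ i 0

/-- Agent `i`'s estimate of `A`: `C₁ C₀ᵀ (C₀ C₀ᵀ)⁻¹ + B̂ᵢ K`. -/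
def estA {m d₁ d₂ : ℕ} (P : Matrix (Fin m) (Fin m) ℝ) (K : Matrix (Fin d₂) (Fin d₁) ℝ)
    (q Tc Te : ℕ) (x : Fin m → ℤ → Vec d₁) (ξ : Fin m → ℤ → Vec d₂) (i : Fin m) :
    Matrix (Fin d₁) (Fin d₁) ℝ :=
  momentBlocks P q Tc Te x ξ i 1 * (momentBlocks P q Tc Te x ξ i 0).transpose *
      (momentBlocks P q Tc Te x ξ i 0 * (momentBlocks P q Tc Te x ξ i 0).transpose)⁻¹ +
    estB P q Tc Te x ξ i * K

/-! ### The two-phase distributed algorithm -/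

/-- All the sequences produced by the `m` agents: states, actions, random excitations, estimated
disturbances, and policy parameters. -/
structure Trajectory (m H d₁ d₂ : ℕ) where
  x : Fin m → ℤ → Vec d₁
  u : Fin m → ℤ → Vec d₂
  ξ : Fin m → ℤ → Vec d₂
  what : Fin m → ℤ → Vec d₁
  M : Fin m → ℤ → Param H d₁ d₂

namespace Trajectory

variable {m H d₁ d₂ : ℕ}

/-- Agent `i`'s estimate of `A` computed from the exploration phase of the trajectory. -/
def hatA (τ : Trajectory m H d₁ d₂) (P : Matrix (Fin m) (Fin m) ℝ)
    (K : Matrix (Fin d₂) (Fin d₁) ℝ) (q Tc Te : ℕ) (i : Fin m) : Matrix (Fin d₁) (Fin d₁) ℝ :=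
  estA P K q Tc Te τ.x τ.ξ i

/-- Agent `i`'s estimate of `B` computed from the exploration phase of the trajectory. -/
def hatB (τ : Trajectory m H d₁ d₂) (P : Matrix (Fin m) (Fin m) ℝ)
    (q Tc Te : ℕ) (i : Fin m) : Matrix (Fin d₁) (Fin d₂) ℝ :=
  estB P q Tc Te τ.x τ.ξ i

/-- Agent `l`'s estimated surrogate of the cost `c`: the function `f_t(· | Âₗ, B̂ₗ, {ŵₗ})` of the
policy sequence. -/
def estimatedCost (τ : Trajectory m H d₁ d₂) (P : Matrix (Fin m) (Fin m) ℝ)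
    (K : Matrix (Fin d₂) (Fin d₁) ℝ) (q Tc Te : ℕ) (c : StateAction d₁ d₂ → ℝ) (l : Fin m)
    (t : ℤ) (M : ℤ → Param H d₁ d₂) : ℝ :=
  surrogateCost c (τ.hatA P K q Tc Te l) (τ.hatB P q Tc Te l) K (τ.what l) t M

/-- The unprojected distributed gradient step of agent `i` at time `t`. -/
def gradientStep (τ : Trajectory m H d₁ d₂) (P : Matrix (Fin m) (Fin m) ℝ)
    (K : Matrix (Fin d₂) (Fin d₁) ℝ) (q Tc Te : ℕ) (η : ℝ)
    (c : Fin m → ℤ → StateAction d₁ d₂ → ℝ) (i : Fin m) (t : ℤ) : Param H d₁ d₂ :=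
  ∑ j, P j i • τ.M j t -
    η • gradient (fun M : Param H d₁ d₂ =>
      τ.estimatedCost P K q Tc Te (c i t) i t fun _ => M) (τ.M i t)

/-- `τ` is a run, up to the horizon `T`, of the two-phase distributed disturbance feedback
controller on the system `(A, B)` with disturbances `w`, for some realization `τ.ξ` of the
`±1`-valued excitations. The exploration phase has length `T₀ = Tc + Te`. The values `τ.M i t`
for `t ≤ T₀` are irrelevant, since they only ever multiply `τ.what i s` with `s ≤ T₀`. -/
structure IsRun (τ : Trajectory m H d₁ d₂) (A : Matrix (Fin d₁) (Fin d₁) ℝ)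
    (B : Matrix (Fin d₁) (Fin d₂) ℝ) (K : Matrix (Fin d₂) (Fin d₁) ℝ) (w : ℤ → Vec d₁)
    (P : Matrix (Fin m) (Fin m) ℝ) (c : Fin m → ℤ → StateAction d₁ d₂ → ℝ)
    (κ γ η : ℝ) (q Tc Te T : ℕ) : Prop where
  /-- The system starts at the origin. -/
  init_state : ∀ i, τ.x i 1 = 0
  /-- The dynamics of every agent. -/
  dynamics : ∀ i (t : ℤ), 1 ≤ t → τ.x i (t + 1) = act A (τ.x i t) + act B (τ.u i t) + w t
  /-- The excitations have entries `±1`. -/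
  excitation : ∀ i (t : ℤ) a, τ.ξ i t a = 1 ∨ τ.ξ i t a = -1
  /-- The control in the exploration phase. -/
  explore : ∀ i (t : ℤ), 1 ≤ t → t ≤ (Tc : ℤ) + Te → τ.u i t = -act K (τ.x i t) + τ.ξ i t
  /-- The control in the learning phase. -/
  control : ∀ i (t : ℤ), (Tc : ℤ) + Te < t → t ≤ T →
    τ.u i t = -act K (τ.x i t) +
      ∑ k : Fin H, act (block (τ.M i t) k) (τ.what i (t - 1 - ((k : ℕ) : ℤ)))
  /-- No disturbance estimate is available before the learning phase. -/
  what_explore : ∀ i (t : ℤ), t ≤ (Tc : ℤ) + Te → τ.what i t = 0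
  /-- The disturbance estimates in the learning phase. -/
  what_learn : ∀ i (t : ℤ), (Tc : ℤ) + Te < t → t ≤ T →
    τ.what i t = τ.x i (t + 1) - act (τ.hatA P K q Tc Te i) (τ.x i t) -
      act (τ.hatB P q Tc Te i) (τ.u i t)
  /-- All agents start the learning phase from the same feasible policy. -/
  init_policy : ∃ M₀ ∈ policySet H d₁ d₂ κ γ, ∀ i, τ.M i ((Tc : ℤ) + Te + 1) = M₀
  /-- The projected distributed gradient step. -/
  update : ∀ i (t : ℤ), (Tc : ℤ) + Te < t → t ≤ T →
    IsProjection (policySet H d₁ d₂ κ γ) (τ.gradientStep P K q Tc Te η c i t) (τ.M i (t + 1))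

/-- The memory-regret of agent `j` against the fixed policy `Mstar`, measured on the estimated
costs:
`∑_{t=T₀+1}^{T} ∑_i [f_{i,t}(M_{j,t-H-1:t} | Âⱼ, B̂ⱼ, {ŵⱼ}) - f_{i,t}(M* | Âᵢ, B̂ᵢ, {ŵᵢ})]`. -/
def memoryRegret (τ : Trajectory m H d₁ d₂) (P : Matrix (Fin m) (Fin m) ℝ)
    (K : Matrix (Fin d₂) (Fin d₁) ℝ) (q Tc Te T : ℕ)
    (c : Fin m → ℤ → StateAction d₁ d₂ → ℝ) (j : Fin m) (Mstar : Param H d₁ d₂) : ℝ :=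
  ∑ t ∈ Finset.Icc ((Tc : ℤ) + Te + 1) (T : ℤ), ∑ i,
    (τ.estimatedCost P K q Tc Te (c i t) j t (τ.M j) -
      τ.estimatedCost P K q Tc Te (c i t) i t fun _ => Mstar)

end Trajectory

/-! ### The quantities in the bound -/

/-- `ζ = 24 W √d₂ κ⁷ / γ²`. -/
def zeta (κ γ W : ℝ) (d₂ : ℕ) : ℝ := 24 * W * √(d₂ : ℝ) * κ ^ 7 / γ ^ 2

/-- `W + ζ ε`. -/
def noiseBound (κ γ W ε : ℝ) (d₂ : ℕ) : ℝ := W + zeta κ γ W d₂ * ε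

/-- The radius `D`. -/
def radius (κ γ W ε : ℝ) (d₂ H : ℕ) : ℝ :=
  noiseBound κ γ W ε d₂ * (κ ^ 2 + 2 * H * (κ + ε) * κ ^ 5) /
      ((γ - 2 * κ ^ 3 * ε) * (1 - κ ^ 2 * (1 - γ + 2 * κ ^ 3 * ε) ^ (H + 1))) +
    2 * noiseBound κ γ W ε d₂ * κ ^ 3 / γ

/-- The factor `κ³(κ+ε)(W+ζε)/(γ-2κ³ε) + (W+ζε)`. -/
def sensitivity (κ γ W ε : ℝ) (d₂ : ℕ) : ℝ :=
  κ ^ 3 * (κ + ε) * noiseBound κ γ W ε d₂ / (γ - 2 * κ ^ 3 * ε) + noiseBound κ γ W ε d₂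

/-- The term for the memory of the costs (`D` is the radius, `S` the sensitivity factor). -/
def memoryTerm (m H T : ℕ) (η Gc D κ ε W' S β : ℝ) : ℝ :=
  η * T * m * H ^ 3 * (Gc * D) ^ 2 * (κ + ε) * κ ^ 3 * W' * (S * √(m : ℝ) / (1 - β))

/-- The term for the errors `ε`, `ε'` of the estimates (`W'` is `W + ζ ε`). -/
def estimationTerm (m H T : ℕ) (Gc D κ γ ε ε' W' ζ : ℝ) : ℝ :=
  m * T * Gc * D * √2 *
    (κ * (2 * κ ^ 5 * ε' * W' / (γ - 2 * κ ^ 3 * ε) ^ 2 +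
        4 * κ ^ 8 * H ^ 2 * (κ + ε) * ε' * W' /
          ((1 - γ + 2 * κ ^ 3 * ε) * (γ - 2 * κ ^ 3 * ε)) +
        (H + 1) * 2 * κ ^ 5 * ε' * W' / ((1 - γ + 2 * κ ^ 3 * ε) * (γ - 2 * κ ^ 3 * ε)) +
        (κ ^ 2 + H * (κ + ε) * 2 * κ ^ 5) / (γ - 2 * κ ^ 3 * ε) * (2 * ζ * ε)) +
      4 * κ ^ 3 * ζ * ε / γ)

/-- The term for the disagreement of the agents. -/
def disagreementTerm (m H T : ℕ) (η Gc D d S β : ℝ) : ℝ :=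
  η * T * m * √(m : ℝ) * Gc * D * d ^ 3 * H * (S ^ 2 / (1 - β))

/-- The term for the squared gradients. -/
def gradientTerm (m H T : ℕ) (η Gc D d S : ℝ) : ℝ :=
  η * T * m * (Gc * D * d * √d * √(H : ℝ) * S) ^ 2

/-- The term for the averaging error of the network. -/
def consensusTerm (m H T : ℕ) (η Gc D d S β : ℝ) : ℝ :=
  1 / η * T * m * (η * Gc * D * d * √d * √(H : ℝ) * S * √(m : ℝ) / (1 - β)) ^ 2

end DistributedControl

end

namespace DistributedControl

/-! ### Matrices acting on Euclidean spaces -/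

section Act

variable {n d e : ℕ}

/-! Fix `t`, `i` and `j`. The regret summand is a sum of four differences: the memory error, from
the actual policy sequence of `j` to its frozen policy `M_{j,t}`; the model error, from the
estimates of `j` to those of `i` at this policy; the disagreement error, from `M_{j,t}` to
`M_{i,t}`; and the optimization error, from `M_{i,t}` to `M*`, all costs then being those of agent
`i`. `Trajectory.IsRun.memoryRegret_le` bounds and sums them.

With a frozen policy the surrogate state and action are affine in `M` (`surrogatePair_const`), so
the cost is convex in `M`. State and action have norm at most `κD` (`norm_surrogatePair_le`) and are
`2S√H`-Lipschitz in `M`, which bounds the gradients by `G = 2 G_c κ D S √H`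
(`gradient_surrogateCost`). The closed loops of all estimated systems have powers decaying at the
common rate `1 - γ'` (`StronglyStable.norm_pow_le`). The estimated disturbances are bounded by `W'`
and, during learning, within `ζε` of the true ones, by an induction over time that controls states,
inputs and estimates together (`Trajectory.IsRun.norm_what`).

The network contracts mean-zero families by `β < 1` (`IsNetworkMatrix.secondSingularValue_spec`),
and a projected step moves an agent at most `ηG` away from its local average, which is itself
feasible. Hence all agents stay within `R = ηG√m/(1-β)` of their mean, and distances between agents
and between consecutive policies are of order `R` (`IsNetworkMatrix.consensus`). This controls the
memory and disagreement errors. The optimization error follows from the usual potential argument,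
with an additional `2GR` per agent and round because gradients are taken before averaging
(`distributed_gradient_descent_regret`). The initial potential is bounded independently of `H` and
`T`, giving `C₂/η`. The model error comes from telescoping differences of powers of the closed loops
(`norm_pow_sub_pow_mul_le`). -/

lemma norm_act_le (A : Matrix (Fin n) (Fin d) ℝ) (x : Vec d) : ‖act A x‖ ≤ ‖A‖ * ‖x‖ :=
  Matrix.l2_opNorm_mulVec A x

lemma norm_act_le_of_le {A : Matrix (Fin n) (Fin d) ℝ} {x : Vec d} {a b : ℝ} (hA : ‖A‖ ≤ a)
    (hx : ‖x‖ ≤ b) : ‖act A x‖ ≤ a * b :=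
  (norm_act_le A x).trans
    (mul_le_mul hA hx (norm_nonneg x) ((norm_nonneg A).trans hA))

/-- `act` as a bilinear map. -/
noncomputable def actₗ : Matrix (Fin n) (Fin d) ℝ →ₗ[ℝ] Vec d →ₗ[ℝ] Vec n :=
  LinearMap.mk₂ ℝ act
    (fun A B x => by ext; simp [act, Matrix.add_mulVec])
    (fun r A x => by ext; simp [act, Matrix.smul_mulVec])
    (fun A x y => by ext; simp [act, Matrix.mulVec_add])
    (fun r A x => by ext; simp [act, Matrix.mulVec_smul])

lemma act_eq (A : Matrix (Fin n) (Fin d) ℝ) (x : Vec d) : act A x = actₗ A x := rfl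

lemma act_add (A B : Matrix (Fin n) (Fin d) ℝ) (x : Vec d) : act (A + B) x = act A x + act B x := by
  simp [act_eq]

lemma act_sub (A B : Matrix (Fin n) (Fin d) ℝ) (x : Vec d) : act (A - B) x = act A x - act B x := by
  simp [act_eq]

lemma act_vec_add (A : Matrix (Fin n) (Fin d) ℝ) (x y : Vec d) :
    act A (x + y) = act A x + act A y := by
  simp [act_eq]

lemma act_vec_sub (A : Matrix (Fin n) (Fin d) ℝ) (x y : Vec d) :
    act A (x - y) = act A x - act A y := by
  simp [act_eq]

lemma act_zero (A : Matrix (Fin n) (Fin d) ℝ) : act A 0 = 0 := by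
  simp [act_eq]

lemma zero_act (x : Vec d) : act (0 : Matrix (Fin n) (Fin d) ℝ) x = 0 := by
  simp [act_eq]

lemma act_smul (r : ℝ) (A : Matrix (Fin n) (Fin d) ℝ) (x : Vec d) : act (r • A) x = r • act A x := by
  simp [act_eq]

lemma act_vec_sum {ι : Type*} (s : Finset ι) (A : Matrix (Fin n) (Fin d) ℝ) (x : ι → Vec d) :
    act A (∑ i ∈ s, x i) = ∑ i ∈ s, act A (x i) := by
  simp [act_eq]

lemma sum_act {ι : Type*} (s : Finset ι) (A : ι → Matrix (Fin n) (Fin d) ℝ) (x : Vec d) :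
    act (∑ i ∈ s, A i) x = ∑ i ∈ s, act (A i) x := by
  simp [act_eq]

lemma act_act (A : Matrix (Fin n) (Fin d) ℝ) (B : Matrix (Fin d) (Fin e) ℝ) (x : Vec e) :
    act A (act B x) = act (A * B) x := by
  simp [act, Matrix.mulVec_mulVec]

lemma one_act (x : Vec d) : act (1 : Matrix (Fin d) (Fin d) ℝ) x = x := by
  simp [act]

lemma norm_matrix_le_of_act {A : Matrix (Fin n) (Fin d) ℝ} {a : ℝ} (ha : 0 ≤ a)
    (h : ∀ x, ‖act A x‖ ≤ a * ‖x‖) : ‖A‖ ≤ a := by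
  rw [Matrix.l2_opNorm_def]
  exact ContinuousLinearMap.opNorm_le_bound _ ha h

lemma norm_one_matrix_le : ‖(1 : Matrix (Fin d) (Fin d) ℝ)‖ ≤ 1 :=
  norm_matrix_le_of_act zero_le_one fun x => by rw [one_act, one_mul]

lemma norm_mul_le_of_le {A : Matrix (Fin n) (Fin d) ℝ} {B : Matrix (Fin d) (Fin e) ℝ} {a b : ℝ}
    (hA : ‖A‖ ≤ a) (hB : ‖B‖ ≤ b) : ‖A * B‖ ≤ a * b :=
  (Matrix.l2_opNorm_mul A B).trans
    (mul_le_mul hA hB (norm_nonneg B) ((norm_nonneg A).trans hA))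

lemma norm_pow_le_of_le {A : Matrix (Fin d) (Fin d) ℝ} {a : ℝ} (hA : ‖A‖ ≤ a) (k : ℕ) :
    ‖A ^ k‖ ≤ a ^ k := by
  induction k with
  | zero => simpa using norm_one_matrix_le
  | succ k ih => rw [pow_succ, pow_succ]; exact norm_mul_le_of_le ih hA

/-- The spectral norm is at most the Frobenius norm. -/
lemma norm_matrix_sq_le_sum (A : Matrix (Fin n) (Fin d) ℝ) : ‖A‖ ^ 2 ≤ ∑ a, ∑ b, A a b ^ 2 := by
  have h0 : 0 ≤ ∑ a, ∑ b, A a b ^ 2 := by positivity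
  have : ‖A‖ ≤ √(∑ a, ∑ b, A a b ^ 2) := by
    refine norm_matrix_le_of_act (Real.sqrt_nonneg _) fun x => ?_
    refine abs_le_of_sq_le_sq' ?_ (by positivity) |>.2
    rw [mul_pow, Real.sq_sqrt h0, EuclideanSpace.norm_sq_eq, EuclideanSpace.norm_sq_eq,
      Finset.sum_mul]
    refine Finset.sum_le_sum fun a _ => ?_
    simp only [act, Matrix.mulVec, dotProduct, Real.norm_eq_abs, sq_abs]
    exact Finset.sum_mul_sq_le_sq_mul_sq _ _ _
  calc ‖A‖ ^ 2 ≤ √(∑ a, ∑ b, A a b ^ 2) ^ 2 := by gcongr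
    _ = _ := Real.sq_sqrt h0

/-- The squared Frobenius norm is at most the number of columns times the squared spectral norm. -/
lemma sum_sq_le_norm_matrix_sq (A : Matrix (Fin n) (Fin d) ℝ) :
    ∑ a, ∑ b, A a b ^ 2 ≤ d * ‖A‖ ^ 2 := by
  rw [Finset.sum_comm]
  calc ∑ b, ∑ a, A a b ^ 2 ≤ ∑ _b : Fin d, ‖A‖ ^ 2 := by
        refine Finset.sum_le_sum fun b _ => ?_
        have h := norm_act_le A (EuclideanSpace.single b 1)
        rw [PiLp.norm_single, norm_one, mul_one] at h
        calc ∑ a, A a b ^ 2 = ‖act A (EuclideanSpace.single b 1)‖ ^ 2 := by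
              rw [EuclideanSpace.norm_sq_eq]; simp [act]
          _ ≤ _ := by gcongr
    _ = _ := by simp

end Act

/-! ### Policy parameters -/

section Policy

variable {H d₁ d₂ : ℕ}

lemma block_add (M N : Param H d₁ d₂) (k : Fin H) : block (M + N) k = block M k + block N k := rfl

lemma block_sub (M N : Param H d₁ d₂) (k : Fin H) : block (M - N) k = block M k - block N k := rfl

lemma block_smul (r : ℝ) (M : Param H d₁ d₂) (k : Fin H) : block (r • M) k = r • block M k := rfl

lemma norm_sq_param (M : Param H d₁ d₂) :
    ‖M‖ ^ 2 = ∑ k : Fin H, ∑ a, ∑ b, block M k a b ^ 2 := by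
  simp [EuclideanSpace.norm_sq_eq, Fintype.sum_prod_type, block]

/-- Cauchy–Schwarz over the `H` blocks, then spectral norm against Frobenius norm. This is the
source of the factor `√H` in the gradient bound. -/
lemma sum_norm_block_le (M : Param H d₁ d₂) : ∑ k : Fin H, ‖block M k‖ ≤ √(H : ℝ) * ‖M‖ := by
  refine abs_le_of_sq_le_sq' ?_ (by positivity) |>.2
  rw [mul_pow, Real.sq_sqrt (by positivity), norm_sq_param]
  calc (∑ k : Fin H, ‖block M k‖) ^ 2 ≤ H * ∑ k : Fin H, ‖block M k‖ ^ 2 := by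
        simpa using sq_sum_le_card_mul_sum_sq (s := Finset.univ) (f := fun k : Fin H => ‖block M k‖)
    _ ≤ _ := by gcongr with k; exact norm_matrix_sq_le_sum _

/-- Convexity serves twice: it makes the projection contract distances to feasible points, and it
keeps the network averages feasible. -/
lemma convex_policySet {κ γ : ℝ} : Convex ℝ (policySet H d₁ d₂ κ γ) := by
  intro M hM N hN a b ha hb hab k
  rw [block_add, block_smul, block_smul]
  calc ‖a • block M k + b • block N k‖ ≤ ‖a • block M k‖ + ‖b • block N k‖ := norm_add_le _ _
    _ = a * ‖block M k‖ + b * ‖block N k‖ := by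
        rw [norm_smul, norm_smul, Real.norm_of_nonneg ha, Real.norm_of_nonneg hb]
    _ ≤ a * (2 * κ ^ 3 * (1 - γ) ^ (k : ℕ)) + b * (2 * κ ^ 3 * (1 - γ) ^ (k : ℕ)) := by
        gcongr
        · exact hM k
        · exact hN k
    _ = _ := by rw [← add_mul, hab, one_mul]

lemma sum_pow_le_inv {ρ : ℝ} (h0 : 0 ≤ ρ) (h1 : ρ < 1) (n : ℕ) :
    ∑ k ∈ Finset.range n, ρ ^ k ≤ 1 / (1 - ρ) := by
  rw [one_div, ← tsum_geometric_of_lt_one h0 h1]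
  exact (summable_geometric_of_lt_one h0 h1).sum_le_tsum _ fun _ _ => by positivity

lemma sum_fin_pow_le_inv {ρ : ℝ} (h0 : 0 ≤ ρ) (h1 : ρ < 1) (n : ℕ) :
    ∑ k : Fin n, ρ ^ (k : ℕ) ≤ 1 / (1 - ρ) := by
  rw [Fin.sum_univ_eq_sum_range (fun k => ρ ^ k)]
  exact sum_pow_le_inv h0 h1 n

/-- The policy set has a Frobenius diameter that does not depend on `H`. -/
lemma norm_sub_sq_le_of_mem_policySet {κ γ : ℝ} (hγ : 0 < γ) (hγ1 : γ ≤ 1)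
    {M N : Param H d₁ d₂} (hM : M ∈ policySet H d₁ d₂ κ γ) (hN : N ∈ policySet H d₁ d₂ κ γ) :
    ‖M - N‖ ^ 2 ≤ 16 * d₁ * κ ^ 6 / γ := by
  have h1 : 0 ≤ 1 - γ := by linarith
  calc ‖M - N‖ ^ 2 ≤ ∑ k : Fin H, (d₁ : ℝ) * ‖block (M - N) k‖ ^ 2 := by
        rw [norm_sq_param]
        exact Finset.sum_le_sum fun k _ => sum_sq_le_norm_matrix_sq _
    _ ≤ ∑ k : Fin H, (d₁ : ℝ) * (16 * κ ^ 6 * (1 - γ) ^ (k : ℕ)) := by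
        gcongr with k
        have hk : ‖block (M - N) k‖ ≤ 4 * κ ^ 3 * (1 - γ) ^ (k : ℕ) := by
          rw [block_sub]
          linarith [norm_sub_le (block M k) (block N k), hM k, hN k]
        calc ‖block (M - N) k‖ ^ 2 ≤ (4 * κ ^ 3 * (1 - γ) ^ (k : ℕ)) ^ 2 := by gcongr
          _ = 16 * κ ^ 6 * ((1 - γ) ^ (k : ℕ) * (1 - γ) ^ (k : ℕ)) := by ring
          -- One of the two equal geometric factors is discarded; the other one sums to at most
          -- `1/γ`, whatever `H` is.
          _ ≤ 16 * κ ^ 6 * ((1 - γ) ^ (k : ℕ) * 1) := by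
              gcongr; exact pow_le_one₀ h1 (by linarith)
          _ = _ := by ring
    _ = d₁ * (16 * κ ^ 6) * ∑ k : Fin H, (1 - γ) ^ (k : ℕ) := by
        rw [Finset.mul_sum]; exact Finset.sum_congr rfl fun _ _ => by ring
    _ ≤ d₁ * (16 * κ ^ 6) * (1 / (1 - (1 - γ))) := by
        gcongr
        exact sum_fin_pow_le_inv h1 (by linarith) H
    _ = _ := by rw [sub_sub_cancel]; ring

end Policy

/-- Projection on a convex set does not increase the distance to the points of the set. -/
lemma IsProjection.norm_sub_le {E : Type*} [NormedAddCommGroup E] [InnerProductSpace ℝ E]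
    {S : Set E} (hS : Convex ℝ S) {x y z : E} (h : IsProjection S x y) (hz : z ∈ S) :
    ‖y - z‖ ≤ ‖x - z‖ := by
  have hinf : ‖x - y‖ = ⨅ w : S, ‖x - w‖ := by
    have : Nonempty S := ⟨⟨y, h.1⟩⟩
    refine le_antisymm (le_ciInf fun w => h.2 w w.2) ?_
    exact ciInf_le ⟨0, by rintro _ ⟨w, rfl⟩; exact norm_nonneg _⟩ (⟨y, h.1⟩ : S)
  -- The angle at the projection is obtuse: `⟪x - y, z - y⟫ ≤ 0`. Expanding the square of `(x - y) -
  -- (z - y)` then gives the claim.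
  have hi := (norm_eq_iInf_iff_real_inner_le_zero hS h.1).1 hinf z hz
  have hx : x - z = (x - y) - (z - y) := by abel
  refine abs_le_of_sq_le_sq' ?_ (norm_nonneg _) |>.2
  rw [hx, norm_sub_sq_real (x - y) (z - y), norm_sub_rev y z]
  nlinarith [sq_nonneg ‖x - y‖]

end DistributedControl

namespace DistributedControl

/-! ### Averaging over the network -/

section Network

variable {m : ℕ} {P : Matrix (Fin m) (Fin m) ℝ}

lemma norm_sq_toEuclideanLin (v : Vec m) :
    ‖Matrix.toEuclideanLin P v‖ ^ 2 = ∑ i, (∑ j, P i j * v j) ^ 2 := by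
  simp [EuclideanSpace.norm_sq_eq, Matrix.toLpLin_apply, Matrix.mulVec, dotProduct]

/-- A doubly stochastic matrix decreases the squared norm by a sum of variances. -/
lemma norm_sq_sub_norm_sq_toEuclideanLin (hP : P ∈ doublyStochastic ℝ (Fin m)) (v : Vec m) :
    ‖v‖ ^ 2 - ‖Matrix.toEuclideanLin P v‖ ^ 2 =
      ∑ i, ∑ j, P i j * (v j - ∑ k, P i k * v k) ^ 2 := by
  -- Row `i` is a probability vector, and the inner sum is the variance of `v` under it. Unit column
  -- sums turn the total of the second moments into `‖v‖ ^ 2`.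
  have h1 : ∀ i, ∑ j, P i j * (v j - ∑ k, P i k * v k) ^ 2 =
      ∑ j, P i j * v j ^ 2 - (∑ k, P i k * v k) ^ 2 := fun i => by
    set a := ∑ k, P i k * v k with ha
    calc ∑ j, P i j * (v j - a) ^ 2
        = ∑ j, (P i j * v j ^ 2 - 2 * a * (P i j * v j) + a ^ 2 * P i j) :=
          Finset.sum_congr rfl fun j _ => by ring
      _ = ∑ j, P i j * v j ^ 2 - 2 * a * a + a ^ 2 * 1 := by
          rw [Finset.sum_add_distrib, Finset.sum_sub_distrib, ← Finset.mul_sum, ← Finset.mul_sum,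
            sum_row_of_mem_doublyStochastic hP i]
      _ = _ := by ring
  have h2 : ∑ i, ∑ j, P i j * v j ^ 2 = ‖v‖ ^ 2 := by
    rw [Finset.sum_comm, EuclideanSpace.norm_sq_eq]
    refine Finset.sum_congr rfl fun j _ => ?_
    rw [← Finset.sum_mul, sum_col_of_mem_doublyStochastic hP j, one_mul, Real.norm_eq_abs, sq_abs]
  rw [Finset.sum_congr rfl fun i _ => h1 i, Finset.sum_sub_distrib, h2, norm_sq_toEuclideanLin]

lemma norm_sq_toEuclideanLin_le (hP : P ∈ doublyStochastic ℝ (Fin m)) (v : Vec m) :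
    ‖Matrix.toEuclideanLin P v‖ ^ 2 ≤ ‖v‖ ^ 2 := by
  rw [← sub_nonneg, norm_sq_sub_norm_sq_toEuclideanLin hP]
  exact Finset.sum_nonneg fun i _ => Finset.sum_nonneg fun j _ =>
    mul_nonneg (nonneg_of_mem_doublyStochastic hP) (sq_nonneg _)

/-- Only constant vectors keep their norm under the averaging of a connected network. -/
lemma IsNetworkMatrix.eq_of_norm_eq (hP : IsNetworkMatrix P) {v : Vec m}
    (hv : ‖Matrix.toEuclideanLin P v‖ ^ 2 = ‖v‖ ^ 2) (a b : Fin m) : v a = v b := by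
  obtain ⟨hsymm, hds, hdiag, hconn⟩ := hP
  have h0 := norm_sq_sub_norm_sq_toEuclideanLin hds v
  rw [hv, sub_self] at h0
  have hnn : ∀ i j, 0 ≤ P i j * (v j - ∑ k, P i k * v k) ^ 2 := fun i j =>
    mul_nonneg (nonneg_of_mem_doublyStochastic hds) (sq_nonneg _)
  have h1 : ∀ i j, P i j * (v j - ∑ k, P i k * v k) ^ 2 = 0 := fun i j => by
    have hi := (Finset.sum_eq_zero_iff_of_nonneg fun i _ =>
      Finset.sum_nonneg fun j _ => hnn i j).1 h0.symm i (Finset.mem_univ i)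
    exact (Finset.sum_eq_zero_iff_of_nonneg fun j _ => hnn i j).1 hi j (Finset.mem_univ j)
  have h2 : ∀ i j, 0 < P i j → v j = ∑ k, P i k * v k := fun i j hij => by
    have := (mul_eq_zero.1 (h1 i j)).resolve_left hij.ne'
    exact sub_eq_zero.1 (pow_eq_zero_iff two_ne_zero |>.1 this)
  -- All variances vanish, so `v` is constant on the support of each row. The positive diagonal puts
  -- `i` in the support of its own row, so `v` agrees across edges.
  have h3 : ∀ i j, 0 < P i j → v i = v j := fun i j hij => by
    rw [h2 i j hij, ← h2 i i (hdiag i)]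
  obtain ⟨p⟩ := hconn.preconnected a b
  induction p with
  | nil => rfl
  | cons hadj _ ih =>
    refine Eq.trans ?_ ih
    rw [SimpleGraph.fromRel_adj] at hadj
    rcases hadj.2 with h | h
    · exact h3 _ _ h
    · exact (h3 _ _ h).symm

lemma toEuclideanLin_const (hP : P ∈ doublyStochastic ℝ (Fin m)) :
    Matrix.toEuclideanLin P (WithLp.toLp 2 fun _ => (1 : ℝ)) = WithLp.toLp 2 fun _ => (1 : ℝ) := by
  ext i
  simpa [Matrix.toLpLin_apply, Matrix.mulVec, dotProduct] using sum_row_of_mem_doublyStochastic hP i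

/-- The second singular value of a network matrix is less than `1`, and it is the contraction
factor on the vectors of mean zero. -/
theorem IsNetworkMatrix.secondSingularValue_spec (hP : IsNetworkMatrix P) :
    0 ≤ secondSingularValue P ∧ secondSingularValue P < 1 ∧
      ∀ z : Vec m, ∑ i, z i = 0 →
        ‖Matrix.toEuclideanLin P z‖ ^ 2 ≤ secondSingularValue P ^ 2 * ‖z‖ ^ 2 := by
  have hds := hP.2.1
  have : Nonempty (Fin m) := hP.2.2.2.nonempty
  have hm : 0 < m := Fin.pos_iff_nonempty.2 inferInstance
  set T := Matrix.toEuclideanLin P with hT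
  set S := T.adjoint ∘ₗ T with hS
  have hSs : S.IsSymmetric := T.isSymmetric_adjoint_comp_self
  have hn : Module.finrank ℝ (Vec m) = m := by simp
  set lam := hSs.eigenvalues hn with hlam
  set e := hSs.eigenvectorBasis hn with he
  have hinner : ∀ x y : Vec m, inner ℝ x (S y) = inner ℝ (T x) (T y) := fun x y => by
    rw [hS, LinearMap.comp_apply, LinearMap.adjoint_inner_right]
  have heS : ∀ k, S (e k) = lam k • e k := fun k =>
    hSs.apply_eigenvectorBasis hn k
  have hlamT : ∀ k, lam k = ‖T (e k)‖ ^ 2 := fun k => by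
    rw [← real_inner_self_eq_norm_sq, ← hinner, heS, inner_smul_right,
      real_inner_self_eq_norm_sq, e.norm_eq_one]
    simp
  have hlam1 : ∀ k, lam k ≤ 1 := fun k => by
    rw [hlamT]
    simpa [e.norm_eq_one] using norm_sq_toEuclideanLin_le hds (e k)
  have hconst : ∀ k, lam k = 1 → ∀ a b, e k a = e k b := fun k hk => by
    refine hP.eq_of_norm_eq ?_
    rw [← hT, ← hlamT, hk, e.norm_eq_one, one_pow]
  have hadj : T.adjoint = T := by
    rw [hT, ← Matrix.toEuclideanLin_conjTranspose_eq_adjoint,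
      Matrix.conjTranspose_eq_transpose_of_trivial,
      hP.1]
  have hone : S (WithLp.toLp 2 fun _ => (1 : ℝ)) = WithLp.toLp 2 fun _ => (1 : ℝ) := by
    rw [hS, LinearMap.comp_apply, hadj, hT, toEuclideanLin_const hds, toEuclideanLin_const hds]
  have hlam0 : lam ⟨0, hm⟩ = 1 := by
    have hev : Module.End.HasEigenvalue S 1 := by
      refine Module.End.hasEigenvalue_of_hasEigenvector
        (x := WithLp.toLp 2 fun _ => (1 : ℝ)) ⟨Module.End.mem_eigenspace_iff.2 ?_, ?_⟩
      · rw [hone, one_smul]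
      · intro h
        have := congrArg (fun v : Vec m => v ⟨0, hm⟩) h
        simp at this
    obtain ⟨i, hi⟩ := hSs.exists_eigenvalues_eq hn hev
    refine le_antisymm (hlam1 _) ?_
    have h1 : lam i = 1 := by simpa using hi
    rw [← h1]
    exact hSs.eigenvalues_antitone hn (Fin.mk_le_mk.2 (Nat.zero_le _))
  have hβ0 : 0 ≤ secondSingularValue P := LinearMap.singularValues_nonneg _ _
  have hβsq : ∀ h1 : 1 < m, secondSingularValue P ^ 2 = lam ⟨1, h1⟩ := fun h1 =>
    T.sq_singularValues_of_lt hn h1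
  have hβ1 : secondSingularValue P < 1 := by
    by_cases h1 : 1 < m
    · refine lt_of_pow_lt_pow_left₀ 2 zero_le_one ?_
      rw [hβsq h1, one_pow]
      -- If the second eigenvalue of `PᵀP` were also `1`, the first two orthonormal eigenvectors
      -- would both be constant vectors; these are nonzero multiples of each other and cannot be
      -- orthogonal.
      refine lt_of_le_of_ne (hlam1 _) fun h => ?_
      have hc0 := hconst _ hlam0
      have hc1 := hconst _ h
      have ho : inner ℝ (e ⟨0, hm⟩) (e ⟨1, h1⟩) = 0 :=
        e.orthonormal.2 (by simp)
      have hs : ∀ k, (∀ a b, e k a = e k b) → ∀ a, e k a ≠ 0 := fun k hk a h0 => by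
        have := e.norm_eq_one k
        rw [show e k = 0 from by ext b; rw [hk b a, h0]; rfl, norm_zero] at this
        exact zero_ne_one this
      simp only [PiLp.inner_apply, RCLike.inner_apply, conj_trivial] at ho
      rw [Finset.sum_congr rfl fun a _ => by rw [hc0 a ⟨0, hm⟩, hc1 a ⟨0, hm⟩]] at ho
      have hmr : (m : ℝ) ≠ 0 := by exact_mod_cast hm.ne'
      simp [hmr, hs _ hc0, hs _ hc1] at ho
    · rw [secondSingularValue, LinearMap.singularValues_of_finrank_le _ (by rw [hn]; omega)]
      exact zero_lt_one
  refine ⟨hβ0, hβ1, fun z hz => ?_⟩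
  have hexp : ‖T z‖ ^ 2 = ∑ k, lam k * inner ℝ (e k) z ^ 2 := by
    rw [← real_inner_self_eq_norm_sq, ← hinner, ← e.sum_inner_mul_inner]
    refine Finset.sum_congr rfl fun k _ => ?_
    rw [← hSs (e k) z, heS, inner_smul_left, real_inner_comm]
    simp only [conj_trivial]
    ring
  have hnorm : ‖z‖ ^ 2 = ∑ k, inner ℝ (e k) z ^ 2 := by
    rw [← real_inner_self_eq_norm_sq, ← e.sum_inner_mul_inner]
    refine Finset.sum_congr rfl fun k _ => ?_
    rw [real_inner_comm]; ring
  rw [hexp, hnorm, Finset.mul_sum]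
  refine Finset.sum_le_sum fun k _ => ?_
  -- The eigenvector of index `0` is constant, so `z` has no component along it; every other
  -- eigenvalue is at most the one of index `1`, which is `β ^ 2`.
  by_cases hk : (k : ℕ) = 0
  · have : inner ℝ (e k) z = 0 := by
      have hk' : k = ⟨0, hm⟩ := Fin.ext hk
      have hc0 := hconst _ hlam0
      rw [hk', PiLp.inner_apply]
      simp only [RCLike.inner_apply, conj_trivial]
      rw [Finset.sum_congr rfl fun a _ => by rw [hc0 a ⟨0, hm⟩], ← Finset.sum_mul, hz, zero_mul]
    rw [this]; simp
  · have h1 : 1 < m := by have := k.2; omega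
    rw [hβsq h1]
    gcongr
    exact hSs.eigenvalues_antitone hn (Fin.mk_le_mk.2 (by omega))

/-- Averaging contracts families of mean zero. -/
theorem IsNetworkMatrix.sum_norm_sq_le (hP : IsNetworkMatrix P) {ι : Type*} [Fintype ι]
    (v : Fin m → EuclideanSpace ℝ ι) (hv : ∑ i, v i = 0) :
    ∑ i, ‖∑ j, P j i • v j‖ ^ 2 ≤ secondSingularValue P ^ 2 * ∑ i, ‖v i‖ ^ 2 := by
  have hsymm : ∀ i j, P j i = P i j := fun i j => hP.1.apply i j
  simp only [EuclideanSpace.norm_sq_eq, Real.norm_eq_abs, sq_abs]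
  rw [Finset.sum_comm, Finset.sum_comm (s := Finset.univ) (t := Finset.univ)
    (f := fun i x => (v i) x ^ 2), Finset.mul_sum]
  refine Finset.sum_le_sum fun x _ => ?_
  -- The averaging acts on each coordinate `x` separately, so the scalar contraction applies
  -- coordinate by coordinate.
  have h := hP.secondSingularValue_spec.2.2 (WithLp.toLp 2 fun i => v i x)
    (by simpa using congrArg (fun f : EuclideanSpace ℝ ι => f x) hv)
  rw [norm_sq_toEuclideanLin, EuclideanSpace.norm_sq_eq] at h
  simpa [hsymm] using h

end Network

end DistributedControl

namespace DistributedControl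

/-! ### Distributed projected gradient descent -/

section Consensus

variable {m : ℕ} {P : Matrix (Fin m) (Fin m) ℝ} {ι : Type*} [Fintype ι]

lemma sum_sub_average {E : Type*} [AddCommGroup E] [Module ℝ E] (hm : 0 < m) (x : Fin m → E) :
    ∑ i, (x i - (m : ℝ)⁻¹ • ∑ l, x l) = 0 := by
  have hmr : (m : ℝ) ≠ 0 := by exact_mod_cast hm.ne'
  rw [Finset.sum_sub_distrib, Finset.sum_const, Finset.card_univ, Fintype.card_fin,
    ← Nat.cast_smul_eq_nsmul ℝ, smul_smul, mul_inv_cancel₀ hmr, one_smul, sub_self]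

/-- The average minimizes the sum of the squared distances. -/
lemma sum_norm_sub_average_sq_le {E : Type*} [NormedAddCommGroup E] [InnerProductSpace ℝ E]
    (hm : 0 < m) (x : Fin m → E) (c : E) :
    ∑ i, ‖x i - (m : ℝ)⁻¹ • ∑ l, x l‖ ^ 2 ≤ ∑ i, ‖x i - c‖ ^ 2 := by
  set a := (m : ℝ)⁻¹ • ∑ l, x l with ha
  have h : ∀ i, ‖x i - c‖ ^ 2 =
      ‖x i - a‖ ^ 2 + 2 * inner ℝ (x i - a) (a - c) + ‖a - c‖ ^ 2 := fun i => by
    rw [← norm_add_sq_real, sub_add_sub_cancel]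
  rw [Finset.sum_congr rfl fun i _ => h i, Finset.sum_add_distrib, Finset.sum_add_distrib,
    ← Finset.mul_sum, ← sum_inner, sum_sub_average hm, inner_zero_left]
  have : 0 ≤ ∑ _i : Fin m, ‖a - c‖ ^ 2 := by positivity
  linarith

/-- Minkowski's inequality in the `ℓ²` sum of `m` copies of `E`. -/
lemma sqrt_sum_norm_add_sq_le {E : Type*} [NormedAddCommGroup E] (x y : Fin m → E) :
    √(∑ i, ‖x i + y i‖ ^ 2) ≤ √(∑ i, ‖x i‖ ^ 2) + √(∑ i, ‖y i‖ ^ 2) := by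
  have h := norm_add_le (WithLp.toLp 2 x : PiLp 2 fun _ : Fin m => E) (WithLp.toLp 2 y)
  simpa [PiLp.norm_eq_of_L2] using h

lemma weighted_sum_sub {E : Type*} [AddCommGroup E] [Module ℝ E] (p : Fin m → ℝ)
    (hp : ∑ j, p j = 1) (x : Fin m → E) (c : E) :
    ∑ j, p j • x j - c = ∑ j, p j • (x j - c) := by
  simp_rw [smul_sub, Finset.sum_sub_distrib]
  rw [← Finset.sum_smul, hp, one_smul]

/-- The agents stay close to their average. -/
theorem IsNetworkMatrix.norm_sub_average_le (hP : IsNetworkMatrix P)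
    {M : Fin m → ℤ → EuclideanSpace ℝ ι} {a b : ℤ} {r : ℝ} (hr : 0 ≤ r)
    (hinit : ∃ M₀, ∀ i, M i a = M₀)
    (hstep : ∀ i t, a ≤ t → t ≤ b → ‖M i (t + 1) - ∑ j, P j i • M j t‖ ≤ r) :
    ∀ t, a ≤ t → t ≤ b + 1 → ∀ i, ‖M i t - (m : ℝ)⁻¹ • ∑ l, M l t‖ ≤
      r * √(m : ℝ) / (1 - secondSingularValue P) := by
  have hm : 0 < m := Fin.pos_iff_nonempty.2 hP.2.2.2.nonempty
  obtain ⟨hβ0, hβ1, -⟩ := hP.secondSingularValue_spec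
  set β := secondSingularValue P with hβ
  set R := r * √(m : ℝ) / (1 - β) with hR
  have h1β : 0 < 1 - β := by linarith
  have hR0 : 0 ≤ R := by positivity
  -- `R` is the fixed point of the recursion `r' ↦ β r' + √m r` satisfied by the `ℓ²` deviation from
  -- the mean, so the bound propagates from the initial deviation `0`.
  have hfix : β * R + √(m : ℝ) * r = R := by
    rw [hR]; field_simp; ring
  have key : ∀ t, a ≤ t → t ≤ b + 1 →
      √(∑ i, ‖M i t - (m : ℝ)⁻¹ • ∑ l, M l t‖ ^ 2) ≤ R := by
    intro t hat
    induction t, hat using Int.leInduction with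
    | base =>
      intro _
      obtain ⟨M₀, hM₀⟩ := hinit
      have hmr : (m : ℝ) ≠ 0 := by exact_mod_cast hm.ne'
      have : ∀ i, M i a - (m : ℝ)⁻¹ • ∑ l, M l a = 0 := fun i => by
        simp only [hM₀, Finset.sum_const, Finset.card_univ, Fintype.card_fin]
        rw [← Nat.cast_smul_eq_nsmul ℝ, smul_smul, inv_mul_cancel₀ hmr, one_smul, sub_self]
      simpa [this] using hR0
    | succ t hat ih =>
      intro htb
      have ih := ih (by linarith)
      set A := (m : ℝ)⁻¹ • ∑ l, M l t with hA
      have hrow : ∀ i, ∑ j, P j i = 1 := sum_col_of_mem_doublyStochastic hP.2.1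
      -- Replacing the new average by the old one only increases the deviation. The rest splits into
      -- a contracted mean-zero family and a local displacement of norm at most `r` for each agent.
      calc √(∑ i, ‖M i (t + 1) - (m : ℝ)⁻¹ • ∑ l, M l (t + 1)‖ ^ 2)
          ≤ √(∑ i, ‖M i (t + 1) - A‖ ^ 2) :=
            Real.sqrt_le_sqrt (sum_norm_sub_average_sq_le hm _ _)
        _ = √(∑ i, ‖(∑ j, P j i • (M j t - A)) +
              (M i (t + 1) - ∑ j, P j i • M j t)‖ ^ 2) := by
            congr 1
            refine Finset.sum_congr rfl fun i _ => ?_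
            rw [← weighted_sum_sub _ (hrow i)]
            congr 2; abel
        _ ≤ √(∑ i, ‖∑ j, P j i • (M j t - A)‖ ^ 2) +
              √(∑ i, ‖M i (t + 1) - ∑ j, P j i • M j t‖ ^ 2) := sqrt_sum_norm_add_sq_le _ _
        _ ≤ √(β ^ 2 * ∑ i, ‖M i t - A‖ ^ 2) + √(∑ _i : Fin m, r ^ 2) := by
            gcongr with i
            · exact hP.sum_norm_sq_le _ (sum_sub_average hm _)
            · exact hstep i t hat (by linarith)
        _ ≤ β * R + √(m : ℝ) * r := by
            rw [Real.sqrt_mul (by positivity), Real.sqrt_sq hβ0]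
            simp only [Finset.sum_const, Finset.card_univ, Fintype.card_fin, nsmul_eq_mul]
            rw [Real.sqrt_mul (by positivity), Real.sqrt_sq hr]
            gcongr
        _ = R := hfix
  intro t hat htb i
  refine le_trans (Real.le_sqrt_of_sq_le ?_) (key t hat htb)
  exact Finset.single_le_sum (f := fun i => ‖M i t - (m : ℝ)⁻¹ • ∑ l, M l t‖ ^ 2)
    (fun _ _ => by positivity) (Finset.mem_univ i)

/-- Consequences of the consensus bound for the pairwise distances, the averaging step, and the
variation over time. -/
theorem IsNetworkMatrix.consensus (hP : IsNetworkMatrix P)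
    {M : Fin m → ℤ → EuclideanSpace ℝ ι} {a b : ℤ} {r : ℝ} (hr : 0 ≤ r)
    (hinit : ∃ M₀, ∀ i, M i a = M₀)
    (hstep : ∀ i t, a ≤ t → t ≤ b → ‖M i (t + 1) - ∑ j, P j i • M j t‖ ≤ r) :
    (∀ t, a ≤ t → t ≤ b + 1 → ∀ i l, ‖M i t - M l t‖ ≤
      2 * (r * √(m : ℝ) / (1 - secondSingularValue P))) ∧
    (∀ t, a ≤ t → t ≤ b + 1 → ∀ i, ‖∑ j, P j i • M j t - M i t‖ ≤
      2 * (r * √(m : ℝ) / (1 - secondSingularValue P))) ∧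
    (∀ t, a ≤ t → t ≤ b → ∀ i, ‖M i (t + 1) - M i t‖ ≤
      3 * (r * √(m : ℝ) / (1 - secondSingularValue P))) := by
  have hm : 0 < m := Fin.pos_iff_nonempty.2 hP.2.2.2.nonempty
  have hds := hP.2.1
  obtain ⟨hβ0, hβ1, -⟩ := hP.secondSingularValue_spec
  have key := hP.norm_sub_average_le hr hinit hstep
  set R := r * √(m : ℝ) / (1 - secondSingularValue P) with hR
  have hrR : r ≤ R := by
    rw [hR, le_div_iff₀ (by linarith)]
    have : 1 ≤ √(m : ℝ) := Real.one_le_sqrt.2 (by exact_mod_cast hm)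
    gcongr
    linarith
  have h1 : ∀ t, a ≤ t → t ≤ b + 1 → ∀ i l, ‖M i t - M l t‖ ≤ 2 * R := fun t ht ht' i l => by
    rw [← sub_sub_sub_cancel_right _ _ ((m : ℝ)⁻¹ • ∑ l, M l t)]
    linarith [norm_sub_le (M i t - (m : ℝ)⁻¹ • ∑ l, M l t) (M l t - (m : ℝ)⁻¹ • ∑ l, M l t),
      key t ht ht' i, key t ht ht' l]
  have h2 : ∀ t, a ≤ t → t ≤ b + 1 → ∀ i, ‖∑ j, P j i • M j t - M i t‖ ≤ 2 * R :=
    fun t ht ht' i => by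
      rw [weighted_sum_sub _ (sum_col_of_mem_doublyStochastic hds i)]
      calc ‖∑ j, P j i • (M j t - M i t)‖ ≤ ∑ j, ‖P j i • (M j t - M i t)‖ := norm_sum_le _ _
        _ ≤ ∑ j, P j i * (2 * R) := by
            gcongr with j
            rw [norm_smul, Real.norm_of_nonneg (nonneg_of_mem_doublyStochastic hds)]
            exact mul_le_mul_of_nonneg_left (h1 t ht ht' j i)
              (nonneg_of_mem_doublyStochastic hds)
        _ = 2 * R := by
            rw [← Finset.sum_mul, sum_col_of_mem_doublyStochastic hds i, one_mul]
  refine ⟨h1, h2, fun t ht ht' i => ?_⟩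
  rw [← sub_add_sub_cancel (M i (t + 1)) (∑ j, P j i • M j t) (M i t)]
  linarith [norm_add_le (M i (t + 1) - ∑ j, P j i • M j t) (∑ j, P j i • M j t - M i t),
    hstep i t ht ht', h2 t ht (by linarith) i]

lemma sum_Icc_sub_le {φ : ℤ → ℝ} (hφ : ∀ t, 0 ≤ φ t) (a b : ℤ) :
    ∑ t ∈ Finset.Icc a b, (φ t - φ (t + 1)) ≤ φ a := by
  rcases lt_or_ge b a with h | h
  · rw [Finset.Icc_eq_empty (by omega), Finset.sum_empty]; exact hφ a
  · have : ∑ t ∈ Finset.Icc a b, (φ t - φ (t + 1)) = φ a - φ (b + 1) := by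
      induction b, h using Int.leInduction with
      | base => simp
      | succ b hab ih =>
        rw [show Finset.Icc a (b + 1) = insert (b + 1) (Finset.Icc a b) by ext; simp; omega,
          Finset.sum_insert (by simp), ih]
        ring
    linarith [hφ (b + 1)]

/-- Jensen's inequality for the square of the norm. -/
lemma norm_weighted_sum_sq_le {E : Type*} [NormedAddCommGroup E] [NormedSpace ℝ E]
    {p : Fin m → ℝ} (hp0 : ∀ j, 0 ≤ p j) (hp : ∑ j, p j = 1) (x : Fin m → E) :
    ‖∑ j, p j • x j‖ ^ 2 ≤ ∑ j, p j * ‖x j‖ ^ 2 := by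
  calc ‖∑ j, p j • x j‖ ^ 2 ≤ (∑ j, p j • ‖x j‖) ^ 2 := by
        gcongr
        refine (norm_sum_le _ _).trans (Finset.sum_le_sum fun j _ => ?_)
        rw [norm_smul, Real.norm_of_nonneg (hp0 j), smul_eq_mul]
    _ ≤ ∑ j, p j • ‖x j‖ ^ 2 :=
        (even_two.convexOn_pow (𝕜 := ℝ)).map_sum_le (fun j _ => hp0 j) hp fun _ _ => Set.mem_univ _

/-- The regret of distributed projected gradient descent. -/
theorem distributed_gradient_descent_regret (hP : P ∈ doublyStochastic ℝ (Fin m))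
    {E : Type*} [NormedAddCommGroup E] [InnerProductSpace ℝ E]
    {M g : Fin m → ℤ → E} {f : Fin m → ℤ → E → ℝ} {x : E} {a b : ℤ} {η G R : ℝ}
    (hη : 0 < η) (hG : 0 ≤ G)
    (hconv : ∀ i t, a ≤ t → t ≤ b → f i t (M i t) - f i t x ≤ inner ℝ (g i t) (M i t - x))
    (hg : ∀ i t, a ≤ t → t ≤ b → ‖g i t‖ ≤ G)
    (hproj : ∀ i t, a ≤ t → t ≤ b →
      ‖M i (t + 1) - x‖ ≤ ‖∑ j, P j i • M j t - η • g i t - x‖)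
    (hR : ∀ t, a ≤ t → t ≤ b → ∀ i, ‖∑ j, P j i • M j t - M i t‖ ≤ R) :
    ∑ t ∈ Finset.Icc a b, ∑ i, (f i t (M i t) - f i t x) ≤
      (∑ i, ‖M i a - x‖ ^ 2) / (2 * η) +
        ((Finset.Icc a b).card : ℝ) * (m * (η * G ^ 2 / 2 + G * R)) := by
  set φ : ℤ → ℝ := fun t => (∑ i, ‖M i t - x‖ ^ 2) / (2 * η) with hφ
  have hstep : ∀ t ∈ Finset.Icc a b, ∑ i, (f i t (M i t) - f i t x) ≤
      (φ t - φ (t + 1)) + m * (η * G ^ 2 / 2 + G * R) := by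
    intro t ht
    rw [Finset.mem_Icc] at ht
    -- Averaging does not increase the potential: Jensen with the weights `P j i` over `j`, then the
    -- sum over `i` of these weights is `1`.
    have hz : ∑ i, ‖∑ j, P j i • M j t - x‖ ^ 2 ≤ ∑ i, ‖M i t - x‖ ^ 2 := by
      calc ∑ i, ‖∑ j, P j i • M j t - x‖ ^ 2 ≤ ∑ i, ∑ j, P j i * ‖M j t - x‖ ^ 2 := by
            gcongr with i
            rw [weighted_sum_sub _ (sum_col_of_mem_doublyStochastic hP i)]
            exact norm_weighted_sum_sq_le (fun j => nonneg_of_mem_doublyStochastic hP)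
              (sum_col_of_mem_doublyStochastic hP i) _
        _ = _ := by
            rw [Finset.sum_comm]
            refine Finset.sum_congr rfl fun j _ => ?_
            rw [← Finset.sum_mul, sum_row_of_mem_doublyStochastic hP j, one_mul]
    have hi : ∀ i, 2 * η * (f i t (M i t) - f i t x) + ‖M i (t + 1) - x‖ ^ 2 ≤
        ‖∑ j, P j i • M j t - x‖ ^ 2 + 2 * η * (η * G ^ 2 / 2 + G * R) := by
      intro i
      set z := ∑ j, P j i • M j t with hz
      have h1 : ‖M i (t + 1) - x‖ ^ 2 ≤ ‖z - x‖ ^ 2 - 2 * η * inner ℝ (g i t) (z - x) +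
          η ^ 2 * ‖g i t‖ ^ 2 := by
        calc ‖M i (t + 1) - x‖ ^ 2 ≤ ‖z - η • g i t - x‖ ^ 2 := by
              gcongr; exact hproj i t ht.1 ht.2
          _ = _ := by
              rw [sub_right_comm, norm_sub_sq_real (z - x), inner_smul_right, norm_smul, mul_pow,
                Real.norm_eq_abs, sq_abs, real_inner_comm]
              ring
      -- The gradient belongs to `M i t`, while the step starts at the average `z`. Passing from one
      -- to the other costs `G * R`.
      have h2 : inner ℝ (g i t) (M i t - x) ≤ inner ℝ (g i t) (z - x) + G * R := by
        have : inner ℝ (g i t) (M i t - x) =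
            inner ℝ (g i t) (z - x) - inner ℝ (g i t) (z - M i t) := by
          rw [← inner_sub_right, sub_sub_sub_cancel_left]
        rw [this]
        have h3 := neg_le_of_abs_le (abs_real_inner_le_norm (g i t) (z - M i t))
        have h4 : ‖g i t‖ * ‖z - M i t‖ ≤ G * R :=
          mul_le_mul (hg i t ht.1 ht.2) (hR t ht.1 ht.2 i) (norm_nonneg _) hG
        linarith
      have h5 : ‖g i t‖ ^ 2 ≤ G ^ 2 := by gcongr; exact hg i t ht.1 ht.2
      have h6 := hconv i t ht.1 ht.2
      have h7 : η ^ 2 * ‖g i t‖ ^ 2 ≤ η ^ 2 * G ^ 2 := by gcongr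
      have h8 : 2 * η * (f i t (M i t) - f i t x) ≤ 2 * η * (inner ℝ (g i t) (z - x) + G * R) := by
        gcongr; linarith
      linarith
    have hsum := Finset.sum_le_sum fun i (_ : i ∈ Finset.univ) => hi i
    rw [Finset.sum_add_distrib, Finset.sum_add_distrib, ← Finset.mul_sum, Finset.sum_const,
      Finset.card_univ, Fintype.card_fin, nsmul_eq_mul] at hsum
    have hfin : 2 * η * ∑ i, (f i t (M i t) - f i t x) ≤
        2 * η * ((φ t - φ (t + 1)) + m * (η * G ^ 2 / 2 + G * R)) := by
      have : 2 * η * (φ t - φ (t + 1)) = ∑ i, ‖M i t - x‖ ^ 2 - ∑ i, ‖M i (t + 1) - x‖ ^ 2 := by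
        simp only [hφ]; field_simp
      rw [mul_add, this]
      linarith
    exact le_of_mul_le_mul_left hfin (by positivity)
  refine (Finset.sum_le_sum hstep).trans ?_
  rw [Finset.sum_add_distrib, Finset.sum_const, nsmul_eq_mul]
  gcongr
  exact sum_Icc_sub_le (φ := φ) (fun t => by simp only [hφ]; positivity) a b

end Consensus

end DistributedControl

namespace DistributedControl

/-! ### Powers of strongly stable matrices -/

section Stability

variable {d₁ d₂ : ℕ}

/-- The inner factors `Q⁻¹ * Q` cancel, so the conjugation costs `κ ^ 2` once and not once per
factor. -/
lemma norm_pow_le_of_similar {F L Q : Matrix (Fin d₁) (Fin d₁) ℝ} {κ ρ : ℝ}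
    (hQ : IsUnit Q.det) (hF : F = Q * L * Q⁻¹) (hL : ‖L‖ ≤ ρ) (hQκ : ‖Q‖ ≤ κ)
    (hQκ' : ‖Q⁻¹‖ ≤ κ) (n : ℕ) : ‖F ^ n‖ ≤ κ ^ 2 * ρ ^ n := by
  have h : F ^ n = Q * L ^ n * Q⁻¹ := by
    induction n with
    | zero => simp [Matrix.mul_nonsing_inv Q hQ]
    | succ n ih =>
      rw [pow_succ, ih, hF, pow_succ]
      calc Q * L ^ n * Q⁻¹ * (Q * L * Q⁻¹) = Q * L ^ n * (Q⁻¹ * Q) * L * Q⁻¹ := by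
            simp only [Matrix.mul_assoc]
        _ = _ := by rw [Matrix.nonsing_inv_mul Q hQ]; simp only [Matrix.mul_assoc, Matrix.one_mul]
  rw [h]
  calc ‖Q * L ^ n * Q⁻¹‖ ≤ κ * ρ ^ n * κ :=
        norm_mul_le_of_le (norm_mul_le_of_le hQκ (norm_pow_le_of_le hL n)) hQκ'
    _ = _ := by ring

variable {A A' : Matrix (Fin d₁) (Fin d₁) ℝ} {B B' : Matrix (Fin d₁) (Fin d₂) ℝ}
  {K : Matrix (Fin d₂) (Fin d₁) ℝ} {κ γ ε : ℝ}

/-- The closed loop of a system close to `(A, B)` has geometrically decaying powers. -/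
lemma StronglyStable.norm_pow_le (h : StronglyStable κ γ A B K) (hκ : 1 ≤ κ)
    (hA : ‖A - A'‖ ≤ ε) (hB : ‖B - B'‖ ≤ ε) (n : ℕ) :
    ‖(A' - B' * K) ^ n‖ ≤ κ ^ 2 * (1 - γ + 2 * κ ^ 3 * ε) ^ n := by
  obtain ⟨hκ0, -, -, hK, L, Q, hQ, hF, hL, hQκ, hQκ'⟩ := h
  have hε : 0 ≤ ε := (norm_nonneg _).trans hA
  have hd : ‖(A' - B' * K) - (A - B * K)‖ ≤ 2 * κ * ε := by
    have : (A' - B' * K) - (A - B * K) = (B - B') * K - (A - A') := by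
      rw [Matrix.sub_mul]; abel
    rw [this]
    have h1 : ‖(B - B') * K‖ ≤ ε * κ := norm_mul_le_of_le hB hK
    have h2 := norm_sub_le ((B - B') * K) (A - A')
    nlinarith
  -- The same `Q` conjugates the perturbed loop. The loop error is at most `2κε`, and conjugation
  -- multiplies this by `κ ^ 2`, so the contraction factor grows by `2κ³ε`.
  refine norm_pow_le_of_similar (L := L + Q⁻¹ * ((A' - B' * K) - (A - B * K)) * Q) hQ ?_ ?_
    hQκ hQκ' n
  · rw [Matrix.mul_add, Matrix.add_mul, ← hF]
    have : Q * (Q⁻¹ * (A' - B' * K - (A - B * K)) * Q) * Q⁻¹ =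
        (Q * Q⁻¹) * (A' - B' * K - (A - B * K)) * (Q * Q⁻¹) := by
      simp only [Matrix.mul_assoc]
    rw [this, Matrix.mul_nonsing_inv Q hQ, Matrix.one_mul, Matrix.mul_one]
    abel
  · calc ‖L + Q⁻¹ * ((A' - B' * K) - (A - B * K)) * Q‖
        ≤ ‖L‖ + ‖Q⁻¹ * ((A' - B' * K) - (A - B * K)) * Q‖ := norm_add_le _ _
      _ ≤ (1 - γ) + κ * (2 * κ * ε) * κ :=
          add_le_add hL (norm_mul_le_of_le (norm_mul_le_of_le hQκ' hd) hQκ)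
      _ = _ := by ring

/-- Telescoping of `F ^ n - G ^ n` into `n` terms with a single factor `F - G`. The trailing `G ^ p`
lets the induction use only bounds on whole powers; multiplying by `‖G‖ ≤ κ²ρ` at each step would
accumulate powers of `κ ^ 2`. -/
lemma norm_pow_sub_pow_mul_le {F G : Matrix (Fin d₁) (Fin d₁) ℝ} {ρ δ : ℝ}
    (hF : ∀ n, ‖F ^ n‖ ≤ κ ^ 2 * ρ ^ n) (hG : ∀ n, ‖G ^ n‖ ≤ κ ^ 2 * ρ ^ n)
    (hFG : ‖F - G‖ ≤ δ) (n p : ℕ) :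
    ‖(F ^ n - G ^ n) * G ^ p‖ ≤ n * (κ ^ 4 * δ) * ρ ^ (n + p - 1) := by
  induction n generalizing p with
  | zero => simp
  | succ n ih =>
    have h : (F ^ (n + 1) - G ^ (n + 1)) * G ^ p =
        F ^ n * (F - G) * G ^ p + (F ^ n - G ^ n) * G ^ (p + 1) := by
      rw [pow_succ F, pow_succ G n, pow_succ' G p]; noncomm_ring
    rw [h]
    calc ‖F ^ n * (F - G) * G ^ p + (F ^ n - G ^ n) * G ^ (p + 1)‖
        ≤ ‖F ^ n * (F - G) * G ^ p‖ + ‖(F ^ n - G ^ n) * G ^ (p + 1)‖ := norm_add_le _ _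
      _ ≤ (κ ^ 2 * ρ ^ n) * δ * (κ ^ 2 * ρ ^ p) + n * (κ ^ 4 * δ) * ρ ^ (n + (p + 1) - 1) :=
          add_le_add (norm_mul_le_of_le (norm_mul_le_of_le (hF n) hFG) (hG p)) (ih (p + 1))
      _ = _ := by
          rw [show n + (p + 1) - 1 = n + p by omega, show n + 1 + p - 1 = n + p by omega]
          push_cast; ring

lemma norm_pow_sub_pow_le {F G : Matrix (Fin d₁) (Fin d₁) ℝ} {ρ δ : ℝ}
    (hF : ∀ n, ‖F ^ n‖ ≤ κ ^ 2 * ρ ^ n) (hG : ∀ n, ‖G ^ n‖ ≤ κ ^ 2 * ρ ^ n)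
    (hFG : ‖F - G‖ ≤ δ) (n : ℕ) :
    ‖F ^ n - G ^ n‖ ≤ n * (κ ^ 4 * δ) * ρ ^ (n - 1) := by
  simpa using norm_pow_sub_pow_mul_le hF hG hFG n 0

/-- Obtained from `∑ n ρ ^ n = ρ / (1 - ρ) ^ 2` by cancelling `ρ`. The truncated exponent at `n = 0`
is harmless, since that term vanishes. -/
lemma sum_mul_pow_pred_le {ρ : ℝ} (h0 : 0 < ρ) (h1 : ρ < 1) (N : ℕ) :
    ∑ n ∈ Finset.range N, (n : ℝ) * ρ ^ (n - 1) ≤ 1 / (1 - ρ) ^ 2 := by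
  have hs := hasSum_coe_mul_geometric_of_norm_lt_one (𝕜 := ℝ) (r := ρ)
    (by rwa [Real.norm_of_nonneg h0.le])
  have h := sum_le_hasSum (Finset.range N) (fun n _ => by positivity) hs
  have h2 : ∑ n ∈ Finset.range N, (n : ℝ) * ρ ^ n =
      ρ * ∑ n ∈ Finset.range N, (n : ℝ) * ρ ^ (n - 1) := by
    rw [Finset.mul_sum]
    refine Finset.sum_congr rfl fun n _ => ?_
    cases n with
    | zero => simp
    | succ n => rw [Nat.add_sub_cancel, pow_succ]; ring
  rw [h2, div_eq_mul_one_div] at h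
  exact le_of_mul_le_mul_left h h0

/-- Bounding each `n` by `N` trades one factor `1 / (1 - ρ)` for `N`; this yields the `H²` term of
`E₂` with a single `1 / γ'`. -/
lemma sum_mul_pow_pred_le' {ρ : ℝ} (h0 : 0 ≤ ρ) (h1 : ρ < 1) (N : ℕ) :
    ∑ n ∈ Finset.range (N + 1), (n : ℝ) * ρ ^ (n - 1) ≤ N * (1 / (1 - ρ)) := by
  rw [Finset.sum_range_succ']
  simp only [Nat.cast_zero, zero_mul, add_zero, Nat.add_sub_cancel]
  calc ∑ n ∈ Finset.range N, ((n + 1 : ℕ) : ℝ) * ρ ^ n ≤ ∑ n ∈ Finset.range N, (N : ℝ) * ρ ^ n := by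
        gcongr with n hn
        have := Finset.mem_range.1 hn
        omega
    _ = N * ∑ n ∈ Finset.range N, ρ ^ n := by rw [Finset.mul_sum]
    _ ≤ _ := by gcongr; exact sum_pow_le_inv h0 h1 N

end Stability

/-! ### Disturbance feedback -/

section Feedback

variable {H d₁ d₂ : ℕ}

/-- The disturbance feedback `∑_{k=1}^{H} M^[k-1] w_{s-k}`, linear in the policy `M`. -/
noncomputable def feedback (w : ℤ → Vec d₁) (s : ℤ) : Param H d₁ d₂ →ₗ[ℝ] Vec d₂ where
  toFun M := ∑ k : Fin H, act (block M k) (w (s - 1 - ((k : ℕ) : ℤ)))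
  map_add' M N := by simp only [block_add, act_add, Finset.sum_add_distrib]
  map_smul' r M := by simp only [block_smul, act_smul, Finset.smul_sum, RingHom.id_apply]

lemma feedback_apply (w : ℤ → Vec d₁) (s : ℤ) (M : Param H d₁ d₂) :
    feedback w s M = ∑ k : Fin H, act (block M k) (w (s - 1 - ((k : ℕ) : ℤ))) := rfl

lemma feedback_sub_left (w w' : ℤ → Vec d₁) (s : ℤ) (M : Param H d₁ d₂) :
    feedback w s M - feedback w' s M = feedback (w - w') s M := by
  simp only [feedback_apply, Pi.sub_apply, act_vec_sub, Finset.sum_sub_distrib]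

/-- Policies before the learning phase are arbitrary; they do no harm because they only multiply
zero disturbance estimates. -/
lemma feedback_eq_zero {w : ℤ → Vec d₁} {s : ℤ} (hw : ∀ r < s, w r = 0) (M : Param H d₁ d₂) :
    feedback w s M = 0 := by
  rw [feedback_apply]
  exact Finset.sum_eq_zero fun k _ => by rw [hw _ (by omega), act_zero]

lemma norm_feedback_le {w : ℤ → Vec d₁} {s : ℤ} {ω : ℝ} (hw : ∀ r < s, ‖w r‖ ≤ ω)
    (M : Param H d₁ d₂) : ‖feedback w s M‖ ≤ √(H : ℝ) * ω * ‖M‖ := by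
  have hω : 0 ≤ ω := (norm_nonneg _).trans (hw (s - 1) (by omega))
  calc ‖feedback w s M‖ ≤ ∑ k : Fin H, ‖block M k‖ * ω :=
        norm_sum_le_of_le _ fun k _ => norm_act_le_of_le le_rfl (hw _ (by omega))
    _ = (∑ k : Fin H, ‖block M k‖) * ω := by rw [Finset.sum_mul]
    _ ≤ √(H : ℝ) * ‖M‖ * ω := by gcongr; exact sum_norm_block_le M
    _ = _ := by ring

/-- For feasible policies the blockwise constraint replaces the Frobenius norm. The sum is
afterwards estimated by `1 / γ` for the action and by `H` for the state, matching the two parts of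
`D`. -/
lemma norm_feedback_le_sum {κ γ : ℝ} {w : ℤ → Vec d₁} {s : ℤ}
    {ω : ℝ} (hw : ∀ r < s, ‖w r‖ ≤ ω) {M : Param H d₁ d₂} (hM : M ∈ policySet H d₁ d₂ κ γ) :
    ‖feedback w s M‖ ≤ 2 * κ ^ 3 * ω * ∑ k : Fin H, (1 - γ) ^ (k : ℕ) := by
  calc ‖feedback w s M‖ ≤ ∑ k : Fin H, (2 * κ ^ 3 * (1 - γ) ^ (k : ℕ)) * ω :=
        norm_sum_le_of_le _ fun k _ => norm_act_le_of_le (hM k) (hw _ (by omega))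
    _ = _ := by rw [Finset.mul_sum]; exact Finset.sum_congr rfl fun _ _ => by ring

lemma norm_feedback_le_inv {κ γ : ℝ} (hκ : 0 ≤ κ) (hγ : 0 < γ) (hγ1 : γ ≤ 1) {w : ℤ → Vec d₁}
    {s : ℤ} {ω : ℝ} (hw : ∀ r < s, ‖w r‖ ≤ ω) {M : Param H d₁ d₂}
    (hM : M ∈ policySet H d₁ d₂ κ γ) : ‖feedback w s M‖ ≤ 2 * κ ^ 3 * ω / γ := by
  have hω : 0 ≤ ω := (norm_nonneg _).trans (hw (s - 1) (by omega))
  refine (norm_feedback_le_sum hw hM).trans ?_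
  rw [div_eq_mul_one_div]
  gcongr
  simpa using sum_fin_pow_le_inv (ρ := 1 - γ) (by linarith) (by linarith) H

lemma norm_feedback_le_card {κ γ : ℝ} (hκ : 0 ≤ κ) (hγ : 0 < γ) (hγ1 : γ ≤ 1) {w : ℤ → Vec d₁}
    {s : ℤ} {ω : ℝ} (hw : ∀ r < s, ‖w r‖ ≤ ω) {M : Param H d₁ d₂}
    (hM : M ∈ policySet H d₁ d₂ κ γ) : ‖feedback w s M‖ ≤ 2 * κ ^ 3 * ω * H := by
  have hω : 0 ≤ ω := (norm_nonneg _).trans (hw (s - 1) (by omega))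
  refine (norm_feedback_le_sum hw hM).trans ?_
  gcongr
  calc ∑ k : Fin H, (1 - γ) ^ (k : ℕ) ≤ ∑ _k : Fin H, (1 : ℝ) := by
        gcongr; exact pow_le_one₀ (by linarith) (by linarith)
    _ = H := by simp

lemma surrogateAction_eq (A : Matrix (Fin d₁) (Fin d₁) ℝ) (B : Matrix (Fin d₁) (Fin d₂) ℝ)
    (K : Matrix (Fin d₂) (Fin d₁) ℝ) (w : ℤ → Vec d₁) (M : ℤ → Param H d₁ d₂) (t : ℤ) :
    surrogateAction A B K w M t = -act K (surrogateState A B K w M t) + feedback w t (M t) := rfl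

/-- The surrogate state is the response of the closed loop to the disturbances and to the
disturbance feedback. -/
theorem surrogateState_eq (A : Matrix (Fin d₁) (Fin d₁) ℝ) (B : Matrix (Fin d₁) (Fin d₂) ℝ)
    (K : Matrix (Fin d₂) (Fin d₁) ℝ) (w : ℤ → Vec d₁) (M : ℤ → Param H d₁ d₂) (t : ℤ) :
    surrogateState A B K w M t =
      ∑ n ∈ Finset.range (H + 1), act ((A - B * K) ^ n) (w (t - 1 - (n : ℤ))) +
      ∑ n ∈ Finset.range (H + 1),
        act ((A - B * K) ^ n * B) (feedback w (t - 1 - (n : ℤ)) (M (t - 1 - (n : ℤ)))) := by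
  simp only [surrogateState, transferMatrix, act_add, Finset.sum_add_distrib, sum_act]
  congr 1
  · have hsub : Finset.range (H + 1) ⊆ Finset.range (2 * H + 1) :=
      Finset.range_mono (by omega)
    rw [← Finset.sum_subset hsub]
    · refine Finset.sum_congr rfl fun n hn => ?_
      rw [if_pos (by have := Finset.mem_range.1 hn; omega)]
    · intro n _ hn
      rw [if_neg (by rw [Finset.mem_range] at hn; omega), zero_act]
  · rw [Finset.sum_comm]
    refine Finset.sum_congr rfl fun n hn => ?_
    rw [Finset.sum_comm, feedback_apply, act_vec_sum]
    refine Finset.sum_congr rfl fun k _ => ?_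
    -- Lag `n` and block `k` meet only at `i = n + k + 1`, which is at most `H + (H - 1) + 1 = 2H`,
    -- so the range of `i` loses nothing.
    rw [Finset.sum_eq_single (n + (k : ℕ) + 1)]
    · rw [if_pos rfl, act_act]
      congr 2
      push_cast; ring
    · intro i _ hi
      rw [if_neg hi, zero_act]
    · intro h
      have := Finset.mem_range.1 hn
      have := k.2
      exact absurd (Finset.mem_range.2 (by omega)) h

end Feedback

/-! ### Bounds for the surrogate states and actions -/

section SurrogateBounds

variable {H d₁ d₂ : ℕ} {A A' : Matrix (Fin d₁) (Fin d₁) ℝ} {B B' : Matrix (Fin d₁) (Fin d₂) ℝ}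
  {K : Matrix (Fin d₂) (Fin d₁) ℝ} {κ γ ρ b ω : ℝ} {w w' : ℤ → Vec d₁}

lemma sum_const_mul_pow_le {a : ℝ} (ha : 0 ≤ a) (h0 : 0 ≤ ρ) (h1 : ρ < 1) (N : ℕ) :
    ∑ n ∈ Finset.range N, a * ρ ^ n ≤ a / (1 - ρ) := by
  rw [← Finset.mul_sum, div_eq_mul_one_div]
  gcongr
  exact sum_pow_le_inv h0 h1 N

lemma norm_surrogateState_le (hκ : 0 ≤ κ) (h0 : 0 ≤ ρ) (h1 : ρ < 1)
    (hpow : ∀ n, ‖(A - B * K) ^ n‖ ≤ κ ^ 2 * ρ ^ n) (hB : ‖B‖ ≤ b) {t : ℤ}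
    (hw : ∀ s < t, ‖w s‖ ≤ ω) {M : ℤ → Param H d₁ d₂}
    (hM : ∀ s < t, ‖feedback w s (M s)‖ ≤ 2 * κ ^ 3 * ω * H) :
    ‖surrogateState A B K w M t‖ ≤
      ω * (κ ^ 2 + 2 * H * b * κ ^ 5) / (1 - ρ) := by
  have hω : 0 ≤ ω := (norm_nonneg _).trans (hw (t - 1) (by omega))
  have hb : 0 ≤ b := (norm_nonneg _).trans hB
  rw [surrogateState_eq, ← Finset.sum_add_distrib]
  calc _ ≤ ∑ n ∈ Finset.range (H + 1), (ω * (κ ^ 2 + 2 * H * b * κ ^ 5)) * ρ ^ n := by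
        refine norm_sum_le_of_le _ fun n _ => (norm_add_le _ _).trans ?_
        have e1 : ‖act ((A - B * K) ^ n) (w (t - 1 - (n : ℤ)))‖ ≤ κ ^ 2 * ρ ^ n * ω :=
          norm_act_le_of_le (hpow n) (hw _ (by omega))
        have e2 : ‖act ((A - B * K) ^ n * B)
            (feedback w (t - 1 - (n : ℤ)) (M (t - 1 - (n : ℤ))))‖ ≤
            κ ^ 2 * ρ ^ n * b * (2 * κ ^ 3 * ω * H) :=
          norm_act_le_of_le (norm_mul_le_of_le (hpow n) hB) (hM _ (by omega))
        calc _ ≤ κ ^ 2 * ρ ^ n * ω + κ ^ 2 * ρ ^ n * b * (2 * κ ^ 3 * ω * H) := add_le_add e1 e2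
          _ = _ := by ring
    _ ≤ _ := sum_const_mul_pow_le (by positivity) h0 h1 _

/-- Dependence of the surrogate state on the policies. -/
lemma norm_surrogateState_sub_le (hpow : ∀ n, ‖(A - B * K) ^ n‖ ≤ κ ^ 2 * ρ ^ n)
    (hB : ‖B‖ ≤ b) {t : ℤ} {M N : ℤ → Param H d₁ d₂} {δ : ℕ → ℝ}
    (hδ : ∀ n ∈ Finset.range (H + 1),
      ‖feedback w (t - 1 - (n : ℤ)) (M (t - 1 - (n : ℤ)) - N (t - 1 - (n : ℤ)))‖ ≤ δ n) :
    ‖surrogateState A B K w M t - surrogateState A B K w N t‖ ≤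
      ∑ n ∈ Finset.range (H + 1), κ ^ 2 * b * ρ ^ n * δ n := by
  rw [surrogateState_eq, surrogateState_eq, add_sub_add_left_eq_sub, ← Finset.sum_sub_distrib]
  refine norm_sum_le_of_le _ fun n hn => ?_
  rw [← act_vec_sub, ← map_sub]
  calc _ ≤ κ ^ 2 * ρ ^ n * b * δ n :=
        norm_act_le_of_le (norm_mul_le_of_le (hpow n) hB) (hδ n hn)
    _ = _ := by ring

/-- Dependence of the surrogate state on the system and on the disturbances. -/
lemma norm_surrogateState_sub_le_of_system {δF δB δw : ℝ} (hκ : 0 ≤ κ) (hγ : 0 < γ)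
    (hγ1 : γ ≤ 1) (h0 : 0 < ρ) (h1 : ρ < 1)
    (hpow : ∀ n, ‖(A - B * K) ^ n‖ ≤ κ ^ 2 * ρ ^ n)
    (hpow' : ∀ n, ‖(A' - B' * K) ^ n‖ ≤ κ ^ 2 * ρ ^ n) (hB : ‖B‖ ≤ b) (hB' : ‖B'‖ ≤ b)
    (hF : ‖(A - B * K) - (A' - B' * K)‖ ≤ δF) (hBB' : ‖B - B'‖ ≤ δB) {t : ℤ}
    (hw : ∀ s < t, ‖w s‖ ≤ ω) (hww' : ∀ s < t, ‖w s - w' s‖ ≤ δw)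
    {M : Param H d₁ d₂} (hM : M ∈ policySet H d₁ d₂ κ γ) :
    ‖surrogateState A B K w (fun _ => M) t - surrogateState A' B' K w' (fun _ => M) t‖ ≤
      κ ^ 4 * δF * ω / (1 - ρ) ^ 2 + 2 * κ ^ 7 * H ^ 2 * b * δF * ω / (1 - ρ) +
      2 * κ ^ 5 * H * δB * ω / (1 - ρ) + (κ ^ 2 + H * b * 2 * κ ^ 5) / (1 - ρ) * δw := by
  have hω : 0 ≤ ω := (norm_nonneg _).trans (hw (t - 1) (by omega))
  have hδw : 0 ≤ δw := (norm_nonneg _).trans (hww' (t - 1) (by omega))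
  have hb : 0 ≤ b := (norm_nonneg _).trans hB
  have hδF : 0 ≤ δF := (norm_nonneg _).trans hF
  have hδB : 0 ≤ δB := (norm_nonneg _).trans hBB'
  have hd := norm_pow_sub_pow_le hpow hpow' hF
  rw [surrogateState_eq, surrogateState_eq, ← Finset.sum_add_distrib, ← Finset.sum_add_distrib,
    ← Finset.sum_sub_distrib]
  set F := A - B * K
  set F' := A' - B' * K
  calc _ ≤ ∑ n ∈ Finset.range (H + 1), (κ ^ 4 * δF * ω * (n * ρ ^ (n - 1)) +
          κ ^ 4 * δF * b * (2 * κ ^ 3 * ω * H) * (n * ρ ^ (n - 1)) +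
          κ ^ 2 * δB * (2 * κ ^ 3 * ω * H) * ρ ^ n +
          (κ ^ 2 * δw + κ ^ 2 * b * (2 * κ ^ 3 * δw * H)) * ρ ^ n) := by
        refine norm_sum_le_of_le _ fun n _ => ?_
        set s := t - 1 - (n : ℤ) with hs
        have hst : s < t := by omega
        have hp : ‖feedback w s M‖ ≤ 2 * κ ^ 3 * ω * H :=
          norm_feedback_le_card hκ hγ hγ1 (fun r hr => hw r (by omega)) hM
        have hq : ‖feedback (w - w') s M‖ ≤ 2 * κ ^ 3 * δw * H :=
          norm_feedback_le_card hκ hγ hγ1 (fun r hr => hww' r (by omega)) hM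
        -- One difference at a time: first the powers of the loop, then `B`, then the disturbances,
        -- both direct and through the feedback.
        have hsplit : act (F ^ n) (w s) + act (F ^ n * B) (feedback w s M) -
            (act (F' ^ n) (w' s) + act (F' ^ n * B') (feedback w' s M)) =
            (act (F ^ n - F' ^ n) (w s) + act ((F ^ n - F' ^ n) * B) (feedback w s M)) +
            (act (F' ^ n * (B - B')) (feedback w s M) +
            (act (F' ^ n) (w s - w' s) + act (F' ^ n * B') (feedback (w - w') s M))) := by
          rw [← feedback_sub_left]
          simp only [act_sub, act_vec_sub, Matrix.sub_mul, Matrix.mul_sub]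
          abel
        rw [hsplit]
        have e1 := norm_act_le_of_le (hd n) (hw s hst)
        have e2 := norm_act_le_of_le (norm_mul_le_of_le (hd n) hB) hp
        have e3 := norm_act_le_of_le (norm_mul_le_of_le (hpow' n) hBB') hp
        have e4 := norm_act_le_of_le (hpow' n) (hww' s hst)
        have e5 := norm_act_le_of_le (norm_mul_le_of_le (hpow' n) hB') hq
        refine (norm_add_le_of_le (norm_add_le_of_le e1 e2) (norm_add_le_of_le e3
          (norm_add_le_of_le e4 e5))).trans (le_of_eq ?_)
        ring
    _ ≤ κ ^ 4 * δF * ω * (1 / (1 - ρ) ^ 2) +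
          κ ^ 4 * δF * b * (2 * κ ^ 3 * ω * H) * (H * (1 / (1 - ρ))) +
          κ ^ 2 * δB * (2 * κ ^ 3 * ω * H) * (1 / (1 - ρ)) +
          (κ ^ 2 * δw + κ ^ 2 * b * (2 * κ ^ 3 * δw * H)) * (1 / (1 - ρ)) := by
        rw [Finset.sum_add_distrib, Finset.sum_add_distrib, Finset.sum_add_distrib,
          ← Finset.mul_sum, ← Finset.mul_sum, ← Finset.mul_sum, ← Finset.mul_sum]
        have g1 := sum_mul_pow_pred_le h0 h1 (H + 1)
        have g2 := sum_mul_pow_pred_le' h0.le h1 H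
        have g3 := sum_pow_le_inv h0.le h1 (H + 1)
        gcongr
    _ = _ := by ring

end SurrogateBounds

end DistributedControl

namespace DistributedControl

/-! ### Convex costs composed with affine maps -/

section Costs

/-- The first-order condition of convexity. -/
lemma sub_le_inner_gradient_of_convexOn {E : Type*} [NormedAddCommGroup E] [InnerProductSpace ℝ E]
    [CompleteSpace E] {f : E → ℝ} (hf : ConvexOn ℝ Set.univ f) {x : E}
    (hd : DifferentiableAt ℝ f x) (y : E) : f x - f y ≤ inner ℝ (gradient f x) (x - y) := by
  have hline : ConvexOn ℝ Set.univ (fun s : ℝ => f (x + s • (y - x))) := by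
    have := hf.comp_affineMap (AffineMap.lineMap (k := ℝ) x y)
    refine this.congr fun s _ => ?_
    simp [AffineMap.lineMap_apply, add_comm]
  have hder : HasDerivAt (fun s : ℝ => f (x + s • (y - x))) (fderiv ℝ f x (y - x)) 0 := by
    have h1 : HasDerivAt (fun s : ℝ => x + s • (y - x)) (y - x) 0 := by
      simpa using ((hasDerivAt_id (0 : ℝ)).smul_const (y - x)).const_add x
    have h2 : HasFDerivAt f (fderiv ℝ f x) (x + (0 : ℝ) • (y - x)) := by
      simpa using hd.hasFDerivAt
    exact h2.comp_hasDerivAt (0 : ℝ) h1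
  have h := hline.le_slope_of_hasDerivAt (Set.mem_univ 0) (Set.mem_univ 1) zero_lt_one hder
  simp only [slope_def_field, one_smul, zero_smul, add_zero, sub_zero, div_one,
    add_sub_cancel] at h
  rw [← neg_sub y x, inner_neg_right, inner_gradient_left]
  linarith

lemma norm_gradient_eq {E : Type*} [NormedAddCommGroup E] [InnerProductSpace ℝ E]
    [CompleteSpace E] (f : E → ℝ) (x : E) : ‖gradient f x‖ = ‖fderiv ℝ f x‖ := by
  rw [← toDual_gradient, LinearIsometryEquiv.norm_map]

/-- The chain rule costs the norm of the linear part, and precomposition with an affine map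
preserves convexity; together these give the gradient bound and the first-order inequality for the
surrogate cost. -/
lemma gradient_comp_affine {E F : Type*} [NormedAddCommGroup E] [InnerProductSpace ℝ E]
    [FiniteDimensional ℝ E] [NormedAddCommGroup F] [InnerProductSpace ℝ F] [CompleteSpace E]
    [CompleteSpace F] {c : F → ℝ} (hc : ConvexOn ℝ Set.univ c) (hd : Differentiable ℝ c)
    (p : F) (L : E →ₗ[ℝ] F) {ℓ : ℝ} (hℓ : 0 ≤ ℓ) (hL : ∀ v, ‖L v‖ ≤ ℓ * ‖v‖) (x : E) :
    ‖gradient (fun v => c (p + L v)) x‖ ≤ ‖gradient c (p + L x)‖ * ℓ ∧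
      ∀ y, c (p + L x) - c (p + L y) ≤ inner ℝ (gradient (fun v => c (p + L v)) x) (x - y) := by
  set L' : E →L[ℝ] F := LinearMap.toContinuousLinearMap L with hL'
  have hfd : HasFDerivAt (fun v => c (p + L v)) ((fderiv ℝ c (p + L x)).comp L') x :=
    (hd (p + L x)).hasFDerivAt.comp x (L'.hasFDerivAt.const_add p)
  refine ⟨?_, fun y => sub_le_inner_gradient_of_convexOn ?_ hfd.differentiableAt y⟩
  · rw [norm_gradient_eq, norm_gradient_eq, hfd.fderiv]
    refine (ContinuousLinearMap.opNorm_comp_le _ _).trans ?_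
    gcongr
    exact ContinuousLinearMap.opNorm_le_bound _ hℓ hL
  · have := hc.comp_affineMap (L.toAffineMap + AffineMap.const ℝ E p)
    refine this.congr fun s _ => ?_
    simp [add_comm]

variable {d₁ d₂ : ℕ}

lemma norm_stateAction_le (z : StateAction d₁ d₂) : ‖z‖ ≤ ‖z.fst‖ + ‖z.snd‖ := by
  refine abs_le_of_sq_le_sq' ?_ (by positivity) |>.2
  rw [WithLp.prod_norm_sq_eq_of_L2]
  nlinarith [norm_nonneg z.fst, norm_nonneg z.snd]

/-- The costs are Lipschitz on bounded sets. -/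
lemma CostAssumption.sub_le {Gc : ℝ} {c : StateAction d₁ d₂ → ℝ} (hc : CostAssumption Gc c)
    {D : ℝ} {z z' : StateAction d₁ d₂} (h1 : ‖z.fst‖ ≤ D) (h2 : ‖z.snd‖ ≤ D)
    (h1' : ‖z'.fst‖ ≤ D) (h2' : ‖z'.snd‖ ≤ D) : c z - c z' ≤ Gc * D * ‖z - z'‖ := by
  -- Convexity of the region keeps the segment from `z'` to `z` where the gradient bound holds, so
  -- the mean value inequality applies.
  have hconv : Convex ℝ {z : StateAction d₁ d₂ | ‖z.fst‖ ≤ D ∧ ‖z.snd‖ ≤ D} := by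
    intro x hx y hy a b ha hb hab
    have hcomb : ∀ {n : ℕ} {u v : Vec n}, ‖u‖ ≤ D → ‖v‖ ≤ D → ‖a • u + b • v‖ ≤ D := by
      intro n u v hu hv
      have := convex_closedBall (0 : Vec n) D (mem_closedBall_zero_iff.2 hu)
        (mem_closedBall_zero_iff.2 hv) ha hb hab
      exact mem_closedBall_zero_iff.1 this
    exact ⟨hcomb hx.1 hy.1, hcomb hx.2 hy.2⟩
  have h := hconv.norm_image_sub_le_of_norm_fderiv_le (f := c) (𝕜 := ℝ) (C := Gc * D)
    (fun x _ => hc.2.1 x)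
    (fun x hx => by rw [← norm_gradient_eq]; exact hc.2.2 D x hx.1 hx.2)
    (x := z') (y := z) ⟨h1', h2'⟩ ⟨h1, h2⟩
  exact (le_abs_self _).trans h

end Costs

/-! ### Regularity of the surrogate costs -/

section SurrogateCost

variable {H d₁ d₂ : ℕ}

/-- The pair of the surrogate state and the surrogate action. -/
noncomputable def surrogatePair (A : Matrix (Fin d₁) (Fin d₁) ℝ) (B : Matrix (Fin d₁) (Fin d₂) ℝ)
    (K : Matrix (Fin d₂) (Fin d₁) ℝ) (w : ℤ → Vec d₁) (t : ℤ) (M : ℤ → Param H d₁ d₂) :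
    StateAction d₁ d₂ :=
  WithLp.toLp 2 (surrogateState A B K w M t, surrogateAction A B K w M t)

lemma surrogateCost_eq (c : StateAction d₁ d₂ → ℝ) (A : Matrix (Fin d₁) (Fin d₁) ℝ)
    (B : Matrix (Fin d₁) (Fin d₂) ℝ) (K : Matrix (Fin d₂) (Fin d₁) ℝ) (w : ℤ → Vec d₁) (t : ℤ)
    (M : ℤ → Param H d₁ d₂) : surrogateCost c A B K w t M = c (surrogatePair A B K w t M) := rfl

/-- The dependence of the surrogate state on a time-invariant policy. -/
noncomputable def surrogateStateLin (A : Matrix (Fin d₁) (Fin d₁) ℝ)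
    (B : Matrix (Fin d₁) (Fin d₂) ℝ) (K : Matrix (Fin d₂) (Fin d₁) ℝ) (w : ℤ → Vec d₁) (t : ℤ) :
    Param H d₁ d₂ →ₗ[ℝ] Vec d₁ :=
  ∑ n ∈ Finset.range (H + 1), actₗ ((A - B * K) ^ n * B) ∘ₗ feedback w (t - 1 - (n : ℤ))

/-- The dependence of the surrogate state and action on a time-invariant policy. -/
noncomputable def surrogatePairLin (A : Matrix (Fin d₁) (Fin d₁) ℝ)
    (B : Matrix (Fin d₁) (Fin d₂) ℝ) (K : Matrix (Fin d₂) (Fin d₁) ℝ) (w : ℤ → Vec d₁) (t : ℤ) :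
    Param H d₁ d₂ →ₗ[ℝ] StateAction d₁ d₂ :=
  (WithLp.linearEquiv 2 ℝ (Vec d₁ × Vec d₂)).symm.toLinearMap ∘ₗ
    (surrogateStateLin A B K w t).prod
      (feedback w t - actₗ K ∘ₗ surrogateStateLin A B K w t)

variable (A A' : Matrix (Fin d₁) (Fin d₁) ℝ) (B B' : Matrix (Fin d₁) (Fin d₂) ℝ)
  (K : Matrix (Fin d₂) (Fin d₁) ℝ) (w w' : ℤ → Vec d₁) (t : ℤ)

lemma surrogateState_const (M : Param H d₁ d₂) :
    surrogateState A B K w (fun _ => M) t =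
      surrogateState A B K w (fun _ => (0 : Param H d₁ d₂)) t + surrogateStateLin A B K w t M := by
  simp [surrogateState_eq, surrogateStateLin, act_eq]

lemma surrogatePair_const (M : Param H d₁ d₂) :
    surrogatePair A B K w t (fun _ => M) =
      surrogatePair A B K w t (fun _ => (0 : Param H d₁ d₂)) + surrogatePairLin A B K w t M := by
  have h1 := surrogateState_const A B K w t M
  have h2 : surrogateAction A B K w (fun _ => M) t =
      surrogateAction A B K w (fun _ => (0 : Param H d₁ d₂)) t +
        (feedback w t M - act K (surrogateStateLin A B K w t M)) := by
    simp only [surrogateAction_eq, h1, act_vec_add, map_zero]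
    abel
  simp only [surrogatePair, h1, h2]
  rfl

variable {A A' B B' K w w' t}

/-- The action is `-K y` plus the feedback, so a change of state counts once directly and at most
`κ` times through `K`. -/
lemma norm_surrogatePair_sub_le {κ : ℝ} (hK : ‖K‖ ≤ κ) (M N : ℤ → Param H d₁ d₂) :
    ‖surrogatePair A B K w t M - surrogatePair A' B' K w' t N‖ ≤
      (1 + κ) * ‖surrogateState A B K w M t - surrogateState A' B' K w' N t‖ +
        ‖feedback w t (M t) - feedback w' t (N t)‖ := by
  refine (norm_stateAction_le _).trans ?_
  have h1 : (surrogatePair A B K w t M - surrogatePair A' B' K w' t N).fst =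
      surrogateState A B K w M t - surrogateState A' B' K w' N t := rfl
  have h2 : (surrogatePair A B K w t M - surrogatePair A' B' K w' t N).snd =
      (feedback w t (M t) - feedback w' t (N t)) -
        act K (surrogateState A B K w M t - surrogateState A' B' K w' N t) := by
    rw [act_vec_sub]
    change surrogateAction A B K w M t - surrogateAction A' B' K w' N t = _
    rw [surrogateAction_eq, surrogateAction_eq]
    abel
  rw [h1, h2]
  have h3 := norm_act_le_of_le hK
    (le_refl ‖surrogateState A B K w M t - surrogateState A' B' K w' N t‖)
  have h4 := norm_sub_le (feedback w t (M t) - feedback w' t (N t))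
    (act K (surrogateState A B K w M t - surrogateState A' B' K w' N t))
  linarith

/-- The closed loop of `(A, B)` is stable with rate `ρ`, and the disturbances up to time `t` are
bounded by `ω`. -/
structure SurrogateAssumptions (κ γ ρ b ω : ℝ) (A : Matrix (Fin d₁) (Fin d₁) ℝ)
    (B : Matrix (Fin d₁) (Fin d₂) ℝ) (K : Matrix (Fin d₂) (Fin d₁) ℝ) (w : ℤ → Vec d₁)
    (t : ℤ) : Prop where
  one_le : 1 ≤ κ
  gamma_pos : 0 < γ
  gamma_le : γ ≤ 1
  rho_pos : 0 < ρ
  rho_lt : ρ < 1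
  norm_K : ‖K‖ ≤ κ
  norm_B : ‖B‖ ≤ b
  norm_pow : ∀ n, ‖(A - B * K) ^ n‖ ≤ κ ^ 2 * ρ ^ n
  norm_w : ∀ s < t, ‖w s‖ ≤ ω

namespace SurrogateAssumptions

variable {κ γ ρ b ω D Gc : ℝ} {c : StateAction d₁ d₂ → ℝ}

lemma omega_nonneg (h : SurrogateAssumptions κ γ ρ b ω A B K w t) : 0 ≤ ω :=
  (norm_nonneg _).trans (h.norm_w (t - 1) (by omega))

lemma b_nonneg (h : SurrogateAssumptions κ γ ρ b ω A B K w t) : 0 ≤ b :=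
  (norm_nonneg _).trans h.norm_B

lemma sensitivity_nonneg (h : SurrogateAssumptions κ γ ρ b ω A B K w t) :
    0 ≤ κ ^ 3 * b * ω / (1 - ρ) + ω := by
  have := h.omega_nonneg
  have := h.b_nonneg
  have := sub_pos.2 h.rho_lt
  have := h.one_le
  positivity

/-- The surrogate states and actions are bounded. -/
lemma norm_surrogatePair_le (h : SurrogateAssumptions κ γ ρ b ω A B K w t)
    (hD : ω * (κ ^ 2 + 2 * H * b * κ ^ 5) / (1 - ρ) + 2 * ω * κ ^ 3 / γ ≤ D)
    {M : ℤ → Param H d₁ d₂}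
    (hM : ∀ s ≤ t, (∀ r < s, w r = 0) ∨ M s ∈ policySet H d₁ d₂ κ γ) :
    ‖(surrogatePair A B K w t M).fst‖ ≤ κ * D ∧ ‖(surrogatePair A B K w t M).snd‖ ≤ κ * D := by
  have hω := h.omega_nonneg
  have hb := h.b_nonneg
  have hρ := sub_pos.2 h.rho_lt
  have hκ : 0 ≤ κ := zero_le_one.trans h.one_le
  have hγ := h.gamma_pos
  have hfb : ∀ s ≤ t, ‖feedback w s (M s)‖ ≤ 2 * κ ^ 3 * ω * H ∧
      ‖feedback w s (M s)‖ ≤ 2 * κ ^ 3 * ω / γ := fun s hs => by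
    rcases hM s hs with h0 | hmem
    · rw [feedback_eq_zero h0, norm_zero]
      constructor <;> positivity
    · exact ⟨norm_feedback_le_card hκ h.gamma_pos h.gamma_le
        (fun r hr => h.norm_w r (by omega)) hmem,
        norm_feedback_le_inv hκ h.gamma_pos h.gamma_le (fun r hr => h.norm_w r (by omega)) hmem⟩
  have hy := norm_surrogateState_le hκ h.rho_pos.le h.rho_lt h.norm_pow h.norm_B h.norm_w
    (M := M) fun s hs => (hfb s hs.le).1
  have hv : ‖surrogateAction A B K w M t‖ ≤
      κ * (ω * (κ ^ 2 + 2 * H * b * κ ^ 5) / (1 - ρ)) + 2 * κ ^ 3 * ω / γ := by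
    rw [surrogateAction_eq]
    refine norm_add_le_of_le ?_ (hfb t le_rfl).2
    rw [norm_neg]
    exact norm_act_le_of_le h.norm_K hy
  set a := ω * (κ ^ 2 + 2 * H * b * κ ^ 5) / (1 - ρ) with ha
  have ha0 : 0 ≤ a := by positivity
  have he : 2 * κ ^ 3 * ω / γ = 2 * ω * κ ^ 3 / γ := by ring
  set e := 2 * ω * κ ^ 3 / γ with he'
  have he0 : 0 ≤ e := by positivity
  have h1 := h.one_le
  -- With `a` bounding the state and `e` the feedback, `a + e ≤ D`; the action is at most `κ a + e ≤
  -- κ (a + e)`. The radius is thus `κ * D`, which is where a factor `κ` in the final bound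
  -- originates.
  constructor
  · change ‖surrogateState A B K w M t‖ ≤ κ * D
    nlinarith
  · change ‖surrogateAction A B K w M t‖ ≤ κ * D
    rw [he] at hv
    nlinarith

/-- The surrogate state and action are Lipschitz in a time-invariant policy. -/
lemma norm_surrogatePair_const_sub_le (h : SurrogateAssumptions κ γ ρ b ω A B K w t)
    (M N : Param H d₁ d₂) :
    ‖surrogatePair A B K w t (fun _ => M) - surrogatePair A B K w t (fun _ => N)‖ ≤
      2 * (κ ^ 3 * b * ω / (1 - ρ) + ω) * √(H : ℝ) * ‖M - N‖ := by
  have hω := h.omega_nonneg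
  have hb := h.b_nonneg
  have hρ := sub_pos.2 h.rho_lt
  have h1 := h.one_le
  refine (norm_surrogatePair_sub_le h.norm_K _ _).trans ?_
  rw [← map_sub]
  have hf : ∀ s ≤ t, ‖feedback w s (M - N)‖ ≤ √(H : ℝ) * ω * ‖M - N‖ := fun s hs =>
    norm_feedback_le (fun r hr => h.norm_w r (by omega)) _
  have hy := norm_surrogateState_sub_le (w := w) (t := t) (M := fun _ => M) (N := fun _ => N)
    h.norm_pow h.norm_B (δ := fun _ => √(H : ℝ) * ω * ‖M - N‖) fun n _ => hf _ (by omega)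
  have hy' : ‖surrogateState A B K w (fun _ => M) t - surrogateState A B K w (fun _ => N) t‖ ≤
      κ ^ 2 * b * (√(H : ℝ) * ω * ‖M - N‖) / (1 - ρ) := by
    refine hy.trans ((Finset.sum_le_sum fun n _ => le_of_eq ?_).trans
      (sum_const_mul_pow_le (a := κ ^ 2 * b * (√(H : ℝ) * ω * ‖M - N‖)) (by positivity)
        h.rho_pos.le h.rho_lt _))
    ring
  calc _ ≤ (κ + κ) * (κ ^ 2 * b * (√(H : ℝ) * ω * ‖M - N‖) / (1 - ρ)) +
        2 * (√(H : ℝ) * ω * ‖M - N‖) := by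
        gcongr
        refine (hf t le_rfl).trans ?_
        have : 0 ≤ √(H : ℝ) * ω * ‖M - N‖ := by positivity
        linarith
    _ = _ := by ring

/-- The gradient of the surrogate cost in a time-invariant policy, and the first-order condition
of its convexity. -/
theorem gradient_surrogateCost (h : SurrogateAssumptions κ γ ρ b ω A B K w t)
    (hD : ω * (κ ^ 2 + 2 * H * b * κ ^ 5) / (1 - ρ) + 2 * ω * κ ^ 3 / γ ≤ D)
    (hc : CostAssumption Gc c) {M : Param H d₁ d₂} (hM : M ∈ policySet H d₁ d₂ κ γ) :
    ‖gradient (fun M : Param H d₁ d₂ => surrogateCost c A B K w t fun _ => M) M‖ ≤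
        Gc * (κ * D) * (2 * (κ ^ 3 * b * ω / (1 - ρ) + ω) * √(H : ℝ)) ∧
      ∀ N : Param H d₁ d₂, surrogateCost c A B K w t (fun _ => M) -
        surrogateCost c A B K w t (fun _ => N) ≤
        inner ℝ (gradient (fun M : Param H d₁ d₂ => surrogateCost c A B K w t fun _ => M) M)
          (M - N) := by
  have hS := h.sensitivity_nonneg
  have hL : ∀ v : Param H d₁ d₂, ‖surrogatePairLin A B K w t v‖ ≤
      2 * (κ ^ 3 * b * ω / (1 - ρ) + ω) * √(H : ℝ) * ‖v‖ := fun v => by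
    have := h.norm_surrogatePair_const_sub_le v 0
    rwa [surrogatePair_const A B K w t v, add_sub_cancel_left, sub_zero] at this
  have hg := gradient_comp_affine hc.1 hc.2.1
    (surrogatePair A B K w t (fun _ => (0 : Param H d₁ d₂))) (surrogatePairLin A B K w t)
    (by positivity) hL M
  simp only [← surrogatePair_const, ← surrogateCost_eq] at hg
  refine ⟨hg.1.trans ?_, hg.2⟩
  have hb := h.norm_surrogatePair_le hD (M := fun _ => M) fun _ _ => Or.inr hM
  gcongr
  exact hc.2.2 _ _ hb.1 hb.2

/-- The surrogate cost is Lipschitz in a time-invariant policy. -/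
theorem surrogateCost_const_sub_le (h : SurrogateAssumptions κ γ ρ b ω A B K w t)
    (hD : ω * (κ ^ 2 + 2 * H * b * κ ^ 5) / (1 - ρ) + 2 * ω * κ ^ 3 / γ ≤ D)
    (hc : CostAssumption Gc c) (hG : 0 ≤ Gc * (κ * D)) {M N : Param H d₁ d₂}
    (hM : M ∈ policySet H d₁ d₂ κ γ) (hN : N ∈ policySet H d₁ d₂ κ γ) :
    surrogateCost c A B K w t (fun _ => M) - surrogateCost c A B K w t (fun _ => N) ≤
      Gc * (κ * D) * (2 * (κ ^ 3 * b * ω / (1 - ρ) + ω) * √(H : ℝ)) * ‖M - N‖ := by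
  have h1 := h.norm_surrogatePair_le hD (M := fun _ => M) fun _ _ => Or.inr hM
  have h2 := h.norm_surrogatePair_le hD (M := fun _ => N) fun _ _ => Or.inr hN
  refine (hc.sub_le h1.1 h1.2 h2.1 h2.2).trans ?_
  rw [mul_assoc (Gc * (κ * D))]
  gcongr
  exact h.norm_surrogatePair_const_sub_le M N

/-- The effect of the memory of the surrogate cost, for a slowly varying policy. -/
theorem surrogateCost_memory_sub_le (h : SurrogateAssumptions κ γ ρ b ω A B K w t)
    (hD : ω * (κ ^ 2 + 2 * H * b * κ ^ 5) / (1 - ρ) + 2 * ω * κ ^ 3 / γ ≤ D)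
    (hc : CostAssumption Gc c) (hG : 0 ≤ Gc * (κ * D)) (hH : 1 ≤ H)
    {M : ℤ → Param H d₁ d₂} {a : ℤ} {δ : ℝ} (hδ : 0 ≤ δ) (hat : a ≤ t)
    (hwa : ∀ s < a, w s = 0)
    (hM : ∀ s, a ≤ s → s ≤ t → M s ∈ policySet H d₁ d₂ κ γ)
    (hstep : ∀ s, a ≤ s → s < t → ‖M (s + 1) - M s‖ ≤ δ) :
    surrogateCost c A B K w t M - surrogateCost c A B K w t (fun _ => M t) ≤
      Gc * (κ * D) * (8 * κ ^ 3 * b * ω * √(H : ℝ) * H ^ 2 * δ) := by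
  have hω := h.omega_nonneg
  have hb := h.b_nonneg
  have hκ1 := h.one_le
  have h1 := h.norm_surrogatePair_le hD (M := M) fun s hs => by
    rcases lt_or_ge s a with hsa | hsa
    · exact Or.inl fun r hr => hwa r (by omega)
    · exact Or.inr (hM s hsa hs)
  have h2 := h.norm_surrogatePair_le hD (M := fun _ => M t) fun _ _ => Or.inr (hM t hat le_rfl)
  refine (hc.sub_le h1.1 h1.2 h2.1 h2.2).trans ?_
  gcongr
  refine (norm_surrogatePair_sub_le h.norm_K _ _).trans ?_
  rw [sub_self, norm_zero, add_zero]
  have hdist : ∀ (n : ℕ), a ≤ t - n → ‖M (t - n) - M t‖ ≤ n * δ := by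
    intro n
    induction n with
    | zero => intro _; simp
    | succ n ih =>
      intro hn
      push_cast at hn ⊢
      have e1 := ih (by omega)
      have e2 := hstep (t - (n + 1)) hn (by omega)
      rw [show t - ((n : ℤ) + 1) + 1 = t - n by ring, norm_sub_rev] at e2
      have e3 := norm_add_le (M (t - (n + 1)) - M (t - n)) (M (t - n) - M t)
      rw [sub_add_sub_cancel] at e3
      linarith
  have hy := norm_surrogateState_sub_le (w := w) (t := t) (M := M) (N := fun _ => M t)
    -- The policy acting at lag `n` is `n + 1 ≤ H + 1` steps old, so it differs from `M t` by at
    -- most `(H + 1) * δ`. Summing over `H + 1` lags gives `(H + 1) ^ 2`.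
    h.norm_pow h.norm_B (δ := fun _ => √(H : ℝ) * ω * ((H + 1) * δ)) fun n hn => by
      rcases lt_or_ge (t - 1 - (n : ℤ)) a with hsa | hsa
      · rw [feedback_eq_zero fun r hr => hwa r (by omega), norm_zero]
        positivity
      · refine (norm_feedback_le (fun r hr => h.norm_w r (by omega)) _).trans ?_
        have hs : t - 1 - (n : ℤ) = t - ((n + 1 : ℕ) : ℤ) := by push_cast; ring
        rw [hs] at hsa ⊢
        gcongr
        refine (hdist (n + 1) hsa).trans ?_
        have : n ≤ H := by have := Finset.mem_range.1 hn; omega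
        gcongr
        exact_mod_cast Nat.succ_le_succ this
  have hH' : (1 : ℝ) ≤ H := by exact_mod_cast hH
  have hρ : ∀ n, ρ ^ n ≤ 1 := fun n => pow_le_one₀ h.rho_pos.le h.rho_lt.le
  have hρ0 := h.rho_pos
  calc _ ≤ (κ + κ) * ∑ n ∈ Finset.range (H + 1),
          κ ^ 2 * b * 1 * (√(H : ℝ) * ω * ((H + 1) * δ)) := by
        gcongr
        refine hy.trans ?_
        gcongr
        exact hρ _
    _ = 2 * κ ^ 3 * b * ω * √(H : ℝ) * (H + 1) ^ 2 * δ := by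
        rw [Finset.sum_const, Finset.card_range, nsmul_eq_mul]
        push_cast; ring
    _ ≤ 2 * κ ^ 3 * b * ω * √(H : ℝ) * (4 * H ^ 2) * δ := by
        gcongr
        nlinarith
    _ = _ := by ring

/-- The effect of an error in the system and in the disturbances on the surrogate cost. -/
theorem surrogateCost_system_sub_le {δ δw : ℝ} (h : SurrogateAssumptions κ γ ρ b ω A B K w t)
    (h' : SurrogateAssumptions κ γ ρ b ω A' B' K w' t)
    (hD : ω * (κ ^ 2 + 2 * H * b * κ ^ 5) / (1 - ρ) + 2 * ω * κ ^ 3 / γ ≤ D)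
    (hc : CostAssumption Gc c) (hG : 0 ≤ Gc * (κ * D))
    (hA : ‖A - A'‖ ≤ δ) (hB : ‖B - B'‖ ≤ δ) (hww' : ∀ s < t, ‖w s - w' s‖ ≤ δw)
    {M : Param H d₁ d₂} (hM : M ∈ policySet H d₁ d₂ κ γ) :
    surrogateCost c A B K w t (fun _ => M) - surrogateCost c A' B' K w' t (fun _ => M) ≤
      Gc * (κ * D) * (2 * (κ * (2 * κ ^ 5 * δ * ω / (1 - ρ) ^ 2 +
        4 * κ ^ 8 * H ^ 2 * b * δ * ω / (ρ * (1 - ρ)) +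
        (H + 1) * 2 * κ ^ 5 * δ * ω / (ρ * (1 - ρ)) +
        (κ ^ 2 + H * b * 2 * κ ^ 5) / (1 - ρ) * δw) + 2 * κ ^ 3 * δw / γ)) := by
  have hω := h.omega_nonneg
  have hb := h.b_nonneg
  have hκ1 := h.one_le
  have hκ0 : 0 ≤ κ := zero_le_one.trans hκ1
  have hρ1 := sub_pos.2 h.rho_lt
  have hρ0 := h.rho_pos
  have hδ : 0 ≤ δ := (norm_nonneg _).trans hA
  have hδw : 0 ≤ δw := (norm_nonneg _).trans (hww' (t - 1) (by omega))
  have hγ := h.gamma_pos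
  have h1 := h.norm_surrogatePair_le hD (M := fun _ => M) fun _ _ => Or.inr hM
  have h2 := h'.norm_surrogatePair_le hD (M := fun _ => M) fun _ _ => Or.inr hM
  refine (hc.sub_le h1.1 h1.2 h2.1 h2.2).trans ?_
  gcongr
  refine (norm_surrogatePair_sub_le h.norm_K _ _).trans ?_
  have hF : ‖(A - B * K) - (A' - B' * K)‖ ≤ 2 * κ * δ := by
    have : (A - B * K) - (A' - B' * K) = (A - A') - (B - B') * K := by
      rw [Matrix.sub_mul]; abel
    rw [this]
    have e1 : ‖(B - B') * K‖ ≤ δ * κ := norm_mul_le_of_le hB h.norm_K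
    have e2 := norm_sub_le (A - A') ((B - B') * K)
    nlinarith
  have hy := norm_surrogateState_sub_le_of_system hκ0 h.gamma_pos h.gamma_le h.rho_pos h.rho_lt
    h.norm_pow h'.norm_pow h.norm_B h'.norm_B hF hB h.norm_w hww' hM
  have hf : ‖feedback w t M - feedback w' t M‖ ≤ 2 * κ ^ 3 * δw / γ := by
    rw [feedback_sub_left]
    exact norm_feedback_le_inv hκ0 h.gamma_pos h.gamma_le hww' hM
  -- The target has `ρ * (1 - ρ)` in two denominators; the extra factor `ρ < 1` only weakens the
  -- bound.
  have hρρ : ρ * (1 - ρ) ≤ 1 - ρ := by nlinarith [h.rho_lt]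
  have hy' : ‖surrogateState A B K w (fun _ => M) t -
      surrogateState A' B' K w' (fun _ => M) t‖ ≤ 2 * κ ^ 5 * δ * ω / (1 - ρ) ^ 2 +
        4 * κ ^ 8 * H ^ 2 * b * δ * ω / (ρ * (1 - ρ)) +
        (H + 1) * 2 * κ ^ 5 * δ * ω / (ρ * (1 - ρ)) +
        (κ ^ 2 + H * b * 2 * κ ^ 5) / (1 - ρ) * δw := by
    refine hy.trans (add_le_add (add_le_add (add_le_add (le_of_eq (by ring)) ?_) ?_) le_rfl)
    · rw [show 2 * κ ^ 7 * H ^ 2 * b * (2 * κ * δ) * ω = 4 * κ ^ 8 * H ^ 2 * b * δ * ω by ring]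
      gcongr
    · calc 2 * κ ^ 5 * H * δ * ω / (1 - ρ) ≤ (H + 1) * 2 * κ ^ 5 * δ * ω / (1 - ρ) := by
            rw [div_le_div_iff_of_pos_right hρ1]
            have : 0 ≤ κ ^ 5 * δ * ω := by positivity
            nlinarith
        _ ≤ _ := by gcongr
  have hpos : 0 ≤ 2 * κ ^ 3 * δw / γ := by positivity
  have h3 : (1 + κ) * ‖surrogateState A B K w (fun _ => M) t -
      surrogateState A' B' K w' (fun _ => M) t‖ ≤ (κ + κ) * _ :=
    mul_le_mul (by linarith) hy' (norm_nonneg _) (by linarith)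
  linarith

end SurrogateAssumptions

end SurrogateCost

end DistributedControl

namespace DistributedControl

/-! ### The estimated disturbances -/

section Disturbance

/-- States of a strongly stable closed loop with bounded input stay bounded. -/
lemma norm_state_le_of_similar {d : ℕ} {F L Q : Matrix (Fin d) (Fin d) ℝ} {κ γ r₀ : ℝ}
    (hκ : 0 ≤ κ) (hγ : 0 < γ) (hQ : IsUnit Q.det) (hF : F = Q * L * Q⁻¹)
    (hL : ‖L‖ ≤ 1 - γ) (hQκ : ‖Q‖ ≤ κ) (hQκ' : ‖Q⁻¹‖ ≤ κ) {x r : ℤ → Vec d} {N : ℤ}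
    (hr₀ : 0 ≤ r₀) (hx1 : x 1 = 0) (hx : ∀ t, 1 ≤ t → t < N → x (t + 1) = act F (x t) + r t)
    (hr : ∀ t, 1 ≤ t → t < N → ‖r t‖ ≤ r₀) :
    ∀ t, 1 ≤ t → t ≤ N → ‖x t‖ ≤ κ ^ 2 * r₀ / γ := by
  -- In the coordinates `Q⁻¹ x` the loop contracts by `1 - γ`, and `κ r₀ / γ` is the fixed point of
  -- `a ↦ (1 - γ) a + κ r₀`.
  have key : ∀ t, 1 ≤ t → t ≤ N → ‖act Q⁻¹ (x t)‖ ≤ κ * r₀ / γ := by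
    intro t ht
    induction t, ht using Int.leInduction with
    | base =>
      intro _
      rw [hx1, act_zero, norm_zero]
      positivity
    | succ t ht ih =>
      intro htN
      have hFQ : Q⁻¹ * F = L * Q⁻¹ := by
        rw [hF, ← Matrix.mul_assoc, ← Matrix.mul_assoc, Matrix.nonsing_inv_mul Q hQ,
          Matrix.one_mul]
      have h1 : act Q⁻¹ (x (t + 1)) = act L (act Q⁻¹ (x t)) + act Q⁻¹ (r t) := by
        rw [hx t ht (by omega), act_vec_add, act_act, act_act, hFQ]
      rw [h1]
      refine (norm_add_le_of_le (norm_act_le_of_le hL (ih (by omega)))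
        (norm_act_le_of_le hQκ' (hr t ht (by omega)))).trans (le_of_eq ?_)
      field_simp
      ring
  intro t ht htN
  have h : x t = act Q (act Q⁻¹ (x t)) := by
    rw [act_act, Matrix.mul_nonsing_inv Q hQ, one_act]
  rw [h]
  refine (norm_act_le_of_le hQκ (key t ht htN)).trans (le_of_eq ?_)
  ring

lemma norm_eq_sqrt_of_sign {d : ℕ} {x : Vec d} (hx : ∀ a, x a = 1 ∨ x a = -1) :
    ‖x‖ = √(d : ℝ) := by
  rw [EuclideanSpace.norm_eq]
  congr 1
  rw [Finset.sum_congr rfl fun a _ => show ‖x a‖ ^ 2 = 1 by rcases hx a with h | h <;> simp [h]]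
  simp

/-- Origin of the constant `24` in `ζ`, in units of `κ⁷ W s / γ²`: the states, with `1 + κ ≤ 2κ`,
contribute at most `14`, the remaining input at most `6`, and `4` is slack. -/
lemma gain_le_zeta {κ γ W s : ℝ} (hκ : 1 ≤ κ) (hγ : 0 < γ) (hγ1 : γ ≤ 1) (hW : 1 ≤ W)
    (hs : 1 ≤ s) :
    (1 + κ) * (κ ^ 2 * (κ * (6 * κ ^ 3 * W * s / γ) + W) / γ) + 6 * κ ^ 3 * W * s / γ ≤
      24 * W * s * κ ^ 7 / γ ^ 2 := by
  have h1 : W ≤ κ ^ 4 * W * s / γ := by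
    rw [le_div_iff₀ hγ]
    have : 1 ≤ κ ^ 4 := one_le_pow₀ hκ
    calc W * γ ≤ W * 1 := by gcongr
      _ = 1 * W * 1 := by ring
      _ ≤ κ ^ 4 * W * s := by gcongr
  have h2 : 6 * κ ^ 3 * W * s / γ ≤ 6 * κ ^ 7 * W * s / γ ^ 2 := by
    have : κ ^ 3 ≤ κ ^ 7 := pow_le_pow_right₀ hκ (by norm_num)
    have : γ ^ 2 ≤ γ := by nlinarith
    gcongr
  have h3 : (1 + κ) * (κ ^ 2 * (κ * (6 * κ ^ 3 * W * s / γ) + W) / γ) ≤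
      (κ + κ) * (κ ^ 2 * (κ * (6 * κ ^ 3 * W * s / γ) + κ ^ 4 * W * s / γ) / γ) := by
    gcongr
  have h4 : (κ + κ) * (κ ^ 2 * (κ * (6 * κ ^ 3 * W * s / γ) + κ ^ 4 * W * s / γ) / γ) =
      14 * κ ^ 7 * W * s / γ ^ 2 := by
    field_simp; ring
  have h5 : 24 * W * s * κ ^ 7 / γ ^ 2 =
      14 * κ ^ 7 * W * s / γ ^ 2 + 6 * κ ^ 7 * W * s / γ ^ 2 + 4 * (W * s * κ ^ 7 / γ ^ 2) := by
    ring
  have h6 : 0 ≤ W * s * κ ^ 7 / γ ^ 2 := by positivity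
  linarith

variable {m H d₁ d₂ : ℕ} {τ : Trajectory m H d₁ d₂} {A : Matrix (Fin d₁) (Fin d₁) ℝ}
  {B : Matrix (Fin d₁) (Fin d₂) ℝ} {K : Matrix (Fin d₂) (Fin d₁) ℝ} {w : ℤ → Vec d₁}
  {P : Matrix (Fin m) (Fin m) ℝ} {c : Fin m → ℤ → StateAction d₁ d₂ → ℝ}
  {κ γ η W ε : ℝ} {q Tc Te T : ℕ}

/-- All policies of the learning phase are feasible. -/
lemma Trajectory.IsRun.mem_policySet (h : τ.IsRun A B K w P c κ γ η q Tc Te T) (i : Fin m) :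
    ∀ t : ℤ, (Tc : ℤ) + Te + 1 ≤ t → t ≤ T + 1 → τ.M i t ∈ policySet H d₁ d₂ κ γ := by
  intro t ht htT
  obtain ⟨M₀, hM₀, hinit⟩ := h.init_policy
  rcases eq_or_lt_of_le ht with rfl | hlt
  · rw [hinit]; exact hM₀
  · have := (h.update i (t - 1) (by omega) (by omega)).1
    rwa [sub_add_cancel] at this

/-- The error of a disturbance estimate is the model error applied to the current state and input,
so bounded states and inputs make it of order `ε`. -/
lemma Trajectory.IsRun.what_sub (h : τ.IsRun A B K w P c κ γ η q Tc Te T) (i : Fin m) {t : ℤ}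
    (ht : (Tc : ℤ) + Te < t) (htT : t ≤ T) :
    τ.what i t - w t = act (A - τ.hatA P K q Tc Te i) (τ.x i t) +
      act (B - τ.hatB P q Tc Te i) (τ.u i t) := by
  rw [h.what_learn i t ht htT, h.dynamics i t (by omega), act_sub, act_sub]
  abel

/-- The estimated disturbances are bounded, and close to the true ones in the learning phase. -/
theorem Trajectory.IsRun.norm_what (h : τ.IsRun A B K w P c κ γ η q Tc Te T) (hd₂ : 0 < d₂)
    (hκ : 1 < κ) (hW : 1 < W) (hB : ‖B‖ ≤ κ) (hw : ∀ t, ‖w t‖ ≤ W)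
    (hK : StronglyStable κ γ A B K) (hε : 0 < ε) (hεγ : ε ≤ γ ^ 2 / (12 * κ ^ 7)) (i : Fin m)
    (hAε : ‖A - τ.hatA P K q Tc Te i‖ ≤ ε) (hBε : ‖B - τ.hatB P q Tc Te i‖ ≤ ε) :
    (∀ t ≤ (T : ℤ), ‖τ.what i t‖ ≤ noiseBound κ γ W ε d₂) ∧
    ∀ t : ℤ, (Tc : ℤ) + Te < t → t ≤ T → ‖τ.what i t - w t‖ ≤ zeta κ γ W d₂ * ε := by
  obtain ⟨-, hγ, hγ1, hKκ, L, Q, hQ, hF, hL, hQκ, hQκ'⟩ := hK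
  have hκ0 : 0 < κ := by linarith
  set s := √(d₂ : ℝ) with hs
  have hs1 : 1 ≤ s := Real.one_le_sqrt.2 (by exact_mod_cast hd₂)
  set ω := noiseBound κ γ W ε d₂ with hω
  have hζ : 0 ≤ zeta κ γ W d₂ := by unfold zeta; positivity
  -- The threshold on `ε` gives `ζε ≤ 2W√d₂`, hence `W' ≤ 3W√d₂`. This bound is free of `ζ`, so the
  -- feedback of estimates into the inputs closes without circularity.
  have hζε : zeta κ γ W d₂ * ε ≤ 2 * W * s := by
    calc zeta κ γ W d₂ * ε ≤ zeta κ γ W d₂ * (γ ^ 2 / (12 * κ ^ 7)) := by gcongr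
      _ = _ := by unfold zeta; rw [← hs]; field_simp; norm_num
  have hω0 : 0 ≤ ω := by rw [hω, noiseBound]; positivity
  have hω3 : ω ≤ 3 * W * s := by
    rw [hω, noiseBound]
    have : W * 1 ≤ W * s := by gcongr
    linarith
  set V := 6 * κ ^ 3 * W * s / γ with hV
  have hsV : s ≤ V := by
    rw [hV, le_div_iff₀ hγ]
    have : 1 ≤ κ ^ 3 := one_le_pow₀ hκ.le
    calc s * γ ≤ s * 1 := by gcongr
      _ = 1 * 1 * 1 * s := by ring
      _ ≤ 6 * κ ^ 3 * W * s := by gcongr; norm_num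
  have hV0 : 0 ≤ V := by linarith
  -- Estimates before `N` bounded by `ω` give an input of norm at most `V` beside `-K x`, hence a
  -- bounded state at `N`, hence an error at most `ζε` at `N`; this restores the bound `ω` for the
  -- next step.
  have step : ∀ N : ℤ, (Tc : ℤ) + Te < N → N ≤ T → (∀ r < N, ‖τ.what i r‖ ≤ ω) →
      ‖τ.what i N - w N‖ ≤ zeta κ γ W d₂ * ε := by
    intro N hN hNT hprev
    have hu : ∀ t, 1 ≤ t → t ≤ N → ∃ v, ‖v‖ ≤ V ∧ τ.u i t = -act K (τ.x i t) + v := by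
      intro t ht htN
      rcases le_or_gt t ((Tc : ℤ) + Te) with hexp | hlearn
      · refine ⟨τ.ξ i t, ?_, h.explore i t ht hexp⟩
        rw [norm_eq_sqrt_of_sign (h.excitation i t)]
        exact hsV
      · refine ⟨feedback (τ.what i) t (τ.M i t), ?_, h.control i t hlearn (by omega)⟩
        refine (norm_feedback_le_inv hκ0.le hγ hγ1 (fun r hr => hprev r (by omega))
          (h.mem_policySet i t (by omega) (by omega))).trans ?_
        rw [hV, show 6 * κ ^ 3 * W * s = 2 * κ ^ 3 * (3 * W * s) by ring]
        gcongr
    have hx := norm_state_le_of_similar hκ0.le hγ hQ hF hL hQκ hQκ' (x := τ.x i)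
      (r := fun t => act B (τ.u i t + act K (τ.x i t)) + w t) (N := N) (r₀ := κ * V + W)
      (by positivity) (h.init_state i)
      (fun t ht htN => by
        rw [h.dynamics i t ht, act_sub, act_vec_add, act_act]; abel)
      (fun t ht htN => by
        obtain ⟨v, hv, hut⟩ := hu t ht htN.le
        rw [hut, neg_add_cancel_comm]
        exact norm_add_le_of_le (norm_act_le_of_le hB hv) (hw t))
      N (by omega) le_rfl
    obtain ⟨v, hv, huN⟩ := hu N (by omega) le_rfl
    set X := κ ^ 2 * (κ * V + W) / γ with hX
    have huN' : ‖τ.u i N‖ ≤ κ * X + V := by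
      rw [huN]
      refine norm_add_le_of_le ?_ hv
      rw [norm_neg]
      exact norm_act_le_of_le hKκ hx
    rw [h.what_sub i hN hNT]
    calc _ ≤ ε * X + ε * (κ * X + V) :=
          norm_add_le_of_le (norm_act_le_of_le hAε hx) (norm_act_le_of_le hBε huN')
      _ = ((1 + κ) * X + V) * ε := by ring
      _ ≤ zeta κ γ W d₂ * ε := by
          gcongr
          exact gain_le_zeta hκ.le hγ hγ1 hW.le hs1
  have hbound : ∀ N : ℤ, (Tc : ℤ) + Te ≤ N → N ≤ T → ∀ r ≤ N, ‖τ.what i r‖ ≤ ω := by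
    intro N hN
    induction N, hN using Int.leInduction with
    | base =>
      intro _ r hr
      rw [h.what_explore i r hr, norm_zero]
      exact hω0
    | succ N hN ih =>
      intro hNT r hr
      rcases eq_or_lt_of_le hr with rfl | hlt
      · have h1 := step (N + 1) (by omega) hNT fun r hr => ih (by omega) r (by omega)
        rw [← sub_add_cancel (τ.what i (N + 1)) (w (N + 1)), hω, noiseBound, add_comm]
        exact norm_add_le_of_le (hw _) h1 |>.trans_eq' (by rw [add_comm])
      · exact ih (by omega) r (by omega)
  have hall : ∀ t ≤ (T : ℤ), ‖τ.what i t‖ ≤ ω := by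
    intro t ht
    rcases le_or_gt t ((Tc : ℤ) + Te) with hexp | hlearn
    · rw [h.what_explore i t hexp, norm_zero]
      exact hω0
    · exact hbound t hlearn.le ht t le_rfl
  exact ⟨hall, fun t ht htT => step t ht htT fun r hr => hall r (by omega)⟩

end Disturbance

end DistributedControl

namespace DistributedControl

/-! ### Collecting the terms of the bound -/

section Terms

variable {m H T : ℕ} {η Gc D κ b W' S β d : ℝ}

/-- This equality fixes `C₁ = 48 = 8 · 3 · 2`: memory, variation over time, and Lipschitz constant.
-/
lemma memory_bound_eq :
    (T : ℝ) * m * (Gc * (κ * D) * (8 * κ ^ 3 * b * W' * √(H : ℝ) * H ^ 2 *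
      (3 * (η * (Gc * (κ * D) * (2 * S * √(H : ℝ))) * √(m : ℝ) / (1 - β))))) =
    48 * κ ^ 2 * (η * T * m * H ^ 3 * (Gc * D) ^ 2 * b * κ ^ 3 * W' *
      (S * √(m : ℝ) / (1 - β))) := by
  have hH : √(H : ℝ) * √(H : ℝ) = H := Real.mul_self_sqrt (by positivity)
  calc _ = 48 * κ ^ 2 * (η * T * m * ((√(H : ℝ) * √(H : ℝ)) * H ^ 2) * (Gc * D) ^ 2 * b *
        κ ^ 3 * W' * (S * √(m : ℝ) / (1 - β))) := by ring
    _ = _ := by rw [hH]; ring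

lemma one_le_dim_factor (hd : 1 ≤ d) : 1 ≤ (d * √d) ^ 2 :=
  one_le_pow₀ (one_le_mul_of_one_le_of_one_le hd (Real.one_le_sqrt.2 hd))

lemma gradient_bound_le (hη : 0 < η) (hd : 1 ≤ d) :
    (T : ℝ) * m * (η * (Gc * (κ * D) * (2 * S * √(H : ℝ))) ^ 2 / 2) ≤
      2 * κ ^ 2 * gradientTerm m H T η Gc D d S := by
  calc _ = 2 * κ ^ 2 * (η * T * m * ((Gc * D * √(H : ℝ) * S) ^ 2 * 1)) := by ring
    _ ≤ 2 * κ ^ 2 * (η * T * m * ((Gc * D * √(H : ℝ) * S) ^ 2 * (d * √d) ^ 2)) := by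
        gcongr; exact one_le_dim_factor hd
    _ = _ := by unfold gradientTerm; ring

/-- The left side contains `√m / (1 - β)` to the first power and no dimension factor. Both `√m / (1
- β)` and `d√d` are at least `1`, so `E₅` dominates. -/
lemma consensus_bound_le (hη : 0 < η) (hd : 1 ≤ d) (hm : 0 < m) (hβ0 : 0 ≤ β) (hβ1 : β < 1) :
    (T : ℝ) * m * (Gc * (κ * D) * (2 * S * √(H : ℝ)) *
      (2 * (η * (Gc * (κ * D) * (2 * S * √(H : ℝ))) * √(m : ℝ) / (1 - β)))) ≤
      8 * κ ^ 2 * consensusTerm m H T η Gc D d S β := by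
  have hy : 1 ≤ √(m : ℝ) / (1 - β) := by
    rw [le_div_iff₀ (by linarith)]
    have : 1 ≤ √(m : ℝ) := Real.one_le_sqrt.2 (by exact_mod_cast hm)
    linarith
  calc _ = 8 * κ ^ 2 * (η * T * m * ((Gc * D * √(H : ℝ) * S) ^ 2 *
        (1 * (√(m : ℝ) / (1 - β) * 1)))) := by ring
    _ ≤ 8 * κ ^ 2 * (η * T * m * ((Gc * D * √(H : ℝ) * S) ^ 2 *
        ((d * √d) ^ 2 * (√(m : ℝ) / (1 - β) * (√(m : ℝ) / (1 - β)))))) := by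
        gcongr
        exact one_le_dim_factor hd
    _ = _ := by unfold consensusTerm; field_simp

end Terms

section Regret

variable {m H d₁ d₂ : ℕ} {τ : Trajectory m H d₁ d₂} {A : Matrix (Fin d₁) (Fin d₁) ℝ}
  {B : Matrix (Fin d₁) (Fin d₂) ℝ} {K : Matrix (Fin d₂) (Fin d₁) ℝ} {w : ℤ → Vec d₁}
  {P : Matrix (Fin m) (Fin m) ℝ} {c : Fin m → ℤ → StateAction d₁ d₂ → ℝ}
  {κ γ η ρ b ω D Gc δ δw : ℝ} {q Tc Te T : ℕ}

/-- The regret in terms of uniform bounds for the estimated systems and disturbances. -/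
theorem Trajectory.IsRun.memoryRegret_le (h : τ.IsRun A B K w P c κ γ η q Tc Te T)
    (hP : IsNetworkMatrix P) (hη : 0 < η) (hH : 1 ≤ H)
    (hc : ∀ i t, CostAssumption Gc (c i t)) (hGD : 0 ≤ Gc * (κ * D))
    (hD : ω * (κ ^ 2 + 2 * H * b * κ ^ 5) / (1 - ρ) + 2 * ω * κ ^ 3 / γ ≤ D)
    (hsur : ∀ i, ∀ t ≤ (T : ℤ), SurrogateAssumptions κ γ ρ b ω (τ.hatA P K q Tc Te i)
      (τ.hatB P q Tc Te i) K (τ.what i) t)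
    (hδ : ∀ i l, ‖τ.hatA P K q Tc Te i - τ.hatA P K q Tc Te l‖ ≤ δ ∧
      ‖τ.hatB P q Tc Te i - τ.hatB P q Tc Te l‖ ≤ δ)
    (hδw : ∀ i l, ∀ t ≤ (T : ℤ), ‖τ.what i t - τ.what l t‖ ≤ δw)
    (j : Fin m) {Mstar : Param H d₁ d₂} (hMstar : Mstar ∈ policySet H d₁ d₂ κ γ) :
    let S := κ ^ 3 * b * ω / (1 - ρ) + ω
    let G := Gc * (κ * D) * (2 * S * √(H : ℝ))
    let R := η * G * √(m : ℝ) / (1 - secondSingularValue P)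
    let X := κ * (2 * κ ^ 5 * δ * ω / (1 - ρ) ^ 2 +
        4 * κ ^ 8 * H ^ 2 * b * δ * ω / (ρ * (1 - ρ)) +
        (H + 1) * 2 * κ ^ 5 * δ * ω / (ρ * (1 - ρ)) +
        (κ ^ 2 + H * b * 2 * κ ^ 5) / (1 - ρ) * δw) + 2 * κ ^ 3 * δw / γ
    τ.memoryRegret P K q Tc Te T c j Mstar ≤
      T * m * (Gc * (κ * D) * (8 * κ ^ 3 * b * ω * √(H : ℝ) * H ^ 2 * (3 * R))) +
      T * m * (Gc * (κ * D) * (2 * X)) + T * m * (G * (2 * R)) +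
      (m * (16 * d₁ * κ ^ 6 / γ)) / (2 * η) +
      (T * m * (η * G ^ 2 / 2) + T * m * (G * (2 * R))) := by
  intro S G R X
  have hs0 := hsur j T le_rfl
  have hω := hs0.omega_nonneg
  have hb := hs0.b_nonneg
  have hκ : 0 ≤ κ := zero_le_one.trans hs0.one_le
  have hγ := hs0.gamma_pos
  have hρ0 := hs0.rho_pos
  have hρ1 := sub_pos.2 hs0.rho_lt
  have hδ0 : 0 ≤ δ := (norm_nonneg _).trans (hδ j j).1
  have hδw0 : 0 ≤ δw := (norm_nonneg _).trans (hδw j j T le_rfl)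
  have hS : 0 ≤ S := hs0.sensitivity_nonneg
  have hG : 0 ≤ G := by positivity
  obtain ⟨hβ0, hβ1, -⟩ := hP.secondSingularValue_spec
  have hβ : 0 < 1 - secondSingularValue P := by linarith
  have hR : 0 ≤ R := by positivity
  have hX : 0 ≤ X := by positivity
  have hds := hP.2.1
  set a : ℤ := (Tc : ℤ) + Te + 1 with ha
  set f : Fin m → ℤ → Param H d₁ d₂ → ℝ := fun i t M =>
    τ.estimatedCost P K q Tc Te (c i t) i t fun _ => M with hf
  set g : Fin m → ℤ → Param H d₁ d₂ := fun i t => gradient (f i t) (τ.M i t) with hg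
  have hmem : ∀ i t, a ≤ t → t ≤ T + 1 → τ.M i t ∈ policySet H d₁ d₂ κ γ := fun i t ht ht' =>
    h.mem_policySet i t ht ht'
  have hgrad : ∀ i t, a ≤ t → t ≤ (T : ℤ) → ‖g i t‖ ≤ G ∧
      ∀ N, f i t (τ.M i t) - f i t N ≤ inner ℝ (g i t) (τ.M i t - N) := fun i t ht ht' =>
    (hsur i t ht').gradient_surrogateCost hD (hc i t) (hmem i t ht (by omega))
  have hproj : ∀ i t, a ≤ t → t ≤ (T : ℤ) → ∀ N ∈ policySet H d₁ d₂ κ γ,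
      ‖τ.M i (t + 1) - N‖ ≤ ‖∑ l, P l i • τ.M l t - η • g i t - N‖ := fun i t ht ht' N hN =>
    (h.update i t (by omega) ht').norm_sub_le convex_policySet hN
  have havg : ∀ i t, a ≤ t → t ≤ (T : ℤ) →
      ∑ l, P l i • τ.M l t ∈ policySet H d₁ d₂ κ γ := fun i t ht ht' =>
    convex_policySet.sum_mem (fun l _ => nonneg_of_mem_doublyStochastic hds)
      (sum_col_of_mem_doublyStochastic hds i) fun l _ => hmem l t ht (by omega)
  -- The local average is feasible, so projecting does not move the gradient step farther from it
  -- than `η‖g‖`.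
  have hstep : ∀ i t, a ≤ t → t ≤ (T : ℤ) →
      ‖τ.M i (t + 1) - ∑ l, P l i • τ.M l t‖ ≤ η * G := fun i t ht ht' => by
    refine (hproj i t ht ht' _ (havg i t ht ht')).trans ?_
    rw [sub_right_comm, sub_self, zero_sub, norm_neg, norm_smul, Real.norm_of_nonneg hη.le]
    gcongr
    exact (hgrad i t ht ht').1
  obtain ⟨M₀, hM₀, hinit⟩ := h.init_policy
  obtain ⟨hpair, hmix, hvar⟩ := hP.consensus (M := τ.M) (a := a) (b := T) (r := η * G)
    (by positivity) ⟨M₀, hinit⟩ hstep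
  have hogd := distributed_gradient_descent_regret hds (M := τ.M) (g := g) (f := f) (x := Mstar)
    (a := a) (b := T) (R := 2 * R) hη hG (fun i t ht ht' => (hgrad i t ht ht').2 Mstar)
    (fun i t ht ht' => (hgrad i t ht ht').1)
    (fun i t ht ht' => hproj i t ht ht' _ hMstar)
    (fun t ht ht' i => hmix t ht (by omega) i)
  have hterm : ∀ t ∈ Finset.Icc a (T : ℤ), ∀ i,
      τ.estimatedCost P K q Tc Te (c i t) j t (τ.M j) - f i t Mstar ≤
      (f i t (τ.M i t) - f i t Mstar) +
        (Gc * (κ * D) * (8 * κ ^ 3 * b * ω * √(H : ℝ) * H ^ 2 * (3 * R)) +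
          Gc * (κ * D) * (2 * X) + G * (2 * R)) := by
    intro t ht i
    rw [Finset.mem_Icc] at ht
    -- Here `e1`, `e2`, `e3` are the memory, model and disagreement errors; what remains is the
    -- optimization error of agent `i`.
    have e1 := (hsur j t ht.2).surrogateCost_memory_sub_le (M := τ.M j) (a := a) (δ := 3 * R)
      hD (hc i t) hGD hH (by positivity) ht.1 (fun s hs => h.what_explore j s (by omega))
      (fun s hs hst => hmem j s hs (by omega)) fun s hs hst => hvar s hs (by omega) j
    have e2 := (hsur j t ht.2).surrogateCost_system_sub_le (hsur i t ht.2) hD (hc i t) hGD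
      (hδ j i).1 (hδ j i).2 (fun s hs => hδw j i s (by omega)) (hmem j t ht.1 (by omega))
    have e3 := (hsur i t ht.2).surrogateCost_const_sub_le hD (hc i t) hGD
      (hmem j t ht.1 (by omega)) (hmem i t ht.1 (by omega))
    have e4 : G * ‖τ.M j t - τ.M i t‖ ≤ G * (2 * R) := by
      gcongr; exact hpair t ht.1 (by omega) j i
    simp only [hf, Trajectory.estimatedCost]
    linarith
  set E := Gc * (κ * D) * (8 * κ ^ 3 * b * ω * √(H : ℝ) * H ^ 2 * (3 * R)) +
          Gc * (κ * D) * (2 * X) + G * (2 * R) with hE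
  have hE0 : 0 ≤ E := by positivity
  have hcard : ((Finset.Icc a (T : ℤ)).card : ℝ) ≤ T := by
    rw [Int.card_Icc]
    exact_mod_cast Int.toNat_le.2 (by omega)
  have hinitial : ∑ i, ‖τ.M i a - Mstar‖ ^ 2 ≤ m * (16 * d₁ * κ ^ 6 / γ) := by
    calc ∑ i, ‖τ.M i a - Mstar‖ ^ 2 ≤ ∑ _i : Fin m, 16 * d₁ * κ ^ 6 / γ := by
          gcongr with i
          rw [hinit i]
          exact norm_sub_sq_le_of_mem_policySet hγ hs0.gamma_le hM₀ hMstar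
      _ = _ := by simp
  calc τ.memoryRegret P K q Tc Te T c j Mstar
      ≤ ∑ t ∈ Finset.Icc a (T : ℤ), ∑ i, ((f i t (τ.M i t) - f i t Mstar) + E) :=
        Finset.sum_le_sum fun t ht => Finset.sum_le_sum fun i _ => hterm t ht i
    _ = ∑ t ∈ Finset.Icc a (T : ℤ), ∑ i, (f i t (τ.M i t) - f i t Mstar) +
          ((Finset.Icc a (T : ℤ)).card : ℝ) * (m * E) := by
        simp only [Finset.sum_add_distrib, Finset.sum_const, Finset.card_univ, Fintype.card_fin,
          nsmul_eq_mul]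
    _ ≤ ((m * (16 * d₁ * κ ^ 6 / γ)) / (2 * η) + T * (m * (η * G ^ 2 / 2 + G * (2 * R)))) +
          T * (m * E) := by
        refine add_le_add (hogd.trans ?_) ?_ <;> gcongr
    _ = _ := by rw [hE]; ring

end Regret

end DistributedControl

/-! ### Choice of the constants and comparison with the five terms -/

theorem mainTheorem5 :
    -- `C₁` is a universal constant
    ∃ C₁ : ℝ, 0 < C₁ ∧
    ∀ (m d₁ d₂ : ℕ) (κ γ : ℝ), 0 < d₂ → 1 < κ → 0 < γ → γ ≤ 1 →
    -- the constant in the `O(1/η)` term depends on `m`, `d₁`, `d₂`, `κ`, `γ` only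
    ∃ C₂ : ℝ, 0 < C₂ ∧
    ∀ (q H Tc Te T : ℕ) (W Gc η ε ε' : ℝ)
      (A : Matrix (Fin d₁) (Fin d₁) ℝ) (B : Matrix (Fin d₁) (Fin d₂) ℝ)
      (K : Matrix (Fin d₂) (Fin d₁) ℝ) (w : ℤ → DistributedControl.Vec d₁)
      (P : Matrix (Fin m) (Fin m) ℝ)
      (c : Fin m → ℤ → DistributedControl.StateAction d₁ d₂ → ℝ)
      (τ : DistributedControl.Trajectory m H d₁ d₂),
    1 ≤ H → q + 1 < Tc → 1 < W → 1 < Gc → 0 < η →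
    -- the network
    DistributedControl.IsNetworkMatrix P →
    -- the system, the disturbances, the costs and the known controller
    ‖A‖ ≤ κ → ‖B‖ ≤ κ → (∀ t, ‖w t‖ ≤ W) →
    (∀ i t, DistributedControl.CostAssumption Gc (c i t)) →
    DistributedControl.StronglyStable κ γ A B K →
    DistributedControl.StronglyControllable q κ (A - B * K) B →
    -- a run of the algorithm
    τ.IsRun A B K w P c κ γ η q Tc Te T →
    -- `ε` and `ε'` bound the errors of the estimates of this run
    0 < ε → ε ≤ γ ^ 2 / (12 * κ ^ 7) →
    (∀ i, ‖A - τ.hatA P K q Tc Te i‖ ≤ ε ∧ ‖B - τ.hatB P q Tc Te i‖ ≤ ε) →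
    (∀ i l, ‖τ.hatA P K q Tc Te i - τ.hatA P K q Tc Te l‖ ≤ ε' ∧
      ‖τ.hatB P q Tc Te i - τ.hatB P q Tc Te l‖ ≤ ε') →
    -- the denominator in `D` is positive
    κ ^ 2 * (1 - γ + 2 * κ ^ 3 * ε) ^ (H + 1) < 1 →
    ∀ (j : Fin m), ∀ Mstar ∈ DistributedControl.policySet H d₁ d₂ κ γ,
      let d : ℝ := ((max d₁ d₂ : ℕ) : ℝ)
      let β : ℝ := DistributedControl.secondSingularValue P
      let ζ : ℝ := DistributedControl.zeta κ γ W d₂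
      let W' : ℝ := DistributedControl.noiseBound κ γ W ε d₂
      let D : ℝ := DistributedControl.radius κ γ W ε d₂ H
      let S : ℝ := DistributedControl.sensitivity κ γ W ε d₂
      τ.memoryRegret P K q Tc Te T c j Mstar ≤
        C₁ * κ ^ 2 * DistributedControl.memoryTerm m H T η Gc D κ ε W' S β +
        C₁ * κ ^ 2 * DistributedControl.estimationTerm m H T Gc D κ γ ε ε' W' ζ +
        C₁ * κ ^ 2 * DistributedControl.disagreementTerm m H T η Gc D d S β +
        C₁ * κ ^ 2 * DistributedControl.gradientTerm m H T η Gc D d S +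
        C₂ * (1 / η) +
        C₁ * κ ^ 2 * DistributedControl.consensusTerm m H T η Gc D d S β := by
  -- `C₂` is half the bound on the initial potential summed over the agents; the `+ 1` keeps it
  -- positive when `m` or `d₁` is `0`.
  refine ⟨48, by norm_num, fun m d₁ d₂ κ γ hd₂ hκ hγ hγ1 => ⟨m * (16 * d₁ * κ ^ 6 / γ) / 2 + 1,
    by positivity, ?_⟩⟩
  intro q H Tc Te T W Gc η ε ε' A B K w P c τ hH hTc hW hGc hη hP hA hB hw hc hK hctrl hrun
    hε hεγ hest hest' hden j Mstar hMstar d β ζ W' D S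
  have hκ0 : 0 < κ := by linarith
  have hκγ : 2 * κ ^ 3 * ε < γ := by
    calc 2 * κ ^ 3 * ε ≤ 2 * κ ^ 3 * (γ ^ 2 / (12 * κ ^ 7)) := by gcongr
      _ = γ * (γ / (6 * κ ^ 4)) := by field_simp; norm_num
      _ < γ * 1 := by
          gcongr
          rw [div_lt_one (by positivity)]
          have : 1 < κ ^ 4 := one_lt_pow₀ hκ (by norm_num)
          linarith
      _ = γ := mul_one γ
  set ρ : ℝ := 1 - γ + 2 * κ ^ 3 * ε with hρ
  have h1ρ : 1 - ρ = γ - 2 * κ ^ 3 * ε := by rw [hρ]; ring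
  have hρ0 : 0 < ρ := by
    have : 0 < 2 * κ ^ 3 * ε := by positivity
    linarith
  have hγ' : 0 < γ - 2 * κ ^ 3 * ε := by linarith
  have hζ : 0 ≤ ζ := by simp only [ζ, DistributedControl.zeta]; positivity
  have hW' : 0 ≤ W' := by simp only [W', DistributedControl.noiseBound]; positivity
  have hwhat := fun i => hrun.norm_what hd₂ hκ hW hB hw hK hε hεγ i (hest i).1 (hest i).2
  have hsur : ∀ i, ∀ t ≤ (T : ℤ), DistributedControl.SurrogateAssumptions κ γ ρ (κ + ε) W'
      (τ.hatA P K q Tc Te i) (τ.hatB P q Tc Te i) K (τ.what i) t := fun i t ht =>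
    { one_le := hκ.le
      gamma_pos := hγ
      gamma_le := hγ1
      rho_pos := hρ0
      rho_lt := by linarith
      norm_K := hK.2.2.2.1
      norm_B := by
        have := norm_sub_le B (B - τ.hatB P q Tc Te i)
        rw [sub_sub_cancel] at this
        linarith [(hest i).2]
      norm_pow := hK.norm_pow_le hκ.le (hest i).1 (hest i).2
      norm_w := fun s hs => (hwhat i).1 s (by omega) }
  have hδw : ∀ i l, ∀ t ≤ (T : ℤ), ‖τ.what i t - τ.what l t‖ ≤ 2 * ζ * ε := fun i l t ht => by
    -- During exploration the estimates need not be close to `w t`, but they are all zero and so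
    -- agree; during learning the comparison passes through `w t`.
    rcases le_or_gt t ((Tc : ℤ) + Te) with hexp | hlearn
    · rw [hrun.what_explore i t hexp, hrun.what_explore l t hexp, sub_zero, norm_zero]
      positivity
    · rw [← sub_sub_sub_cancel_right _ _ (w t)]
      have e1 : ‖τ.what i t - w t‖ ≤ ζ * ε := (hwhat i).2 t hlearn ht
      have e2 : ‖τ.what l t - w t‖ ≤ ζ * ε := (hwhat l).2 t hlearn ht
      linarith [norm_sub_le (τ.what i t - w t) (τ.what l t - w t)]
  have hden0 : 0 < 1 - κ ^ 2 * ρ ^ (H + 1) := by linarith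
  -- The factor `1 - κ² ρ^(H+1)` in the denominator of `D` lies in `(0, 1]` and only enlarges `D`.
  have hD : W' * (κ ^ 2 + 2 * H * (κ + ε) * κ ^ 5) / (1 - ρ) + 2 * W' * κ ^ 3 / γ ≤ D := by
    rw [h1ρ]
    simp only [D, DistributedControl.radius]
    gcongr
    refine mul_le_of_le_one_right hγ'.le ?_
    have : 0 ≤ κ ^ 2 * ρ ^ (H + 1) := by positivity
    linarith
  have hD0 : 0 ≤ D := by
    refine le_trans ?_ hD
    rw [h1ρ]
    positivity
  have hGc0 : 0 < Gc := by linarith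
  have hε' : 0 ≤ ε' := (norm_nonneg _).trans (hest' j j).1
  have hd : 1 ≤ d := by
    have : 1 ≤ max d₁ d₂ := le_max_of_le_right hd₂
    exact Nat.one_le_cast.2 this
  have hm : 0 < m := Fin.pos_iff_nonempty.2 hP.2.2.2.nonempty
  obtain ⟨hβ0, hβ1, -⟩ := hP.secondSingularValue_spec
  have hβ : 0 < 1 - β := by linarith
  have hreg := hrun.memoryRegret_le hP hη hH hc (by positivity) hD hsur hest' hδw j hMstar
  dsimp only at hreg
  rw [h1ρ] at hreg
  have hS : 0 ≤ S := by
    simp only [S, DistributedControl.sensitivity]; positivity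
  change τ.memoryRegret P K q Tc Te T c j Mstar ≤
      T * m * (Gc * (κ * D) * (8 * κ ^ 3 * (κ + ε) * W' * √(H : ℝ) * H ^ 2 *
        (3 * (η * (Gc * (κ * D) * (2 * S * √(H : ℝ))) * √(m : ℝ) / (1 - β))))) +
      T * m * (Gc * (κ * D) * (2 * _)) +
      T * m * (Gc * (κ * D) * (2 * S * √(H : ℝ)) *
        (2 * (η * (Gc * (κ * D) * (2 * S * √(H : ℝ))) * √(m : ℝ) / (1 - β)))) + _ +
      (T * m * (η * (Gc * (κ * D) * (2 * S * √(H : ℝ))) ^ 2 / 2) +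
        T * m * (Gc * (κ * D) * (2 * S * √(H : ℝ)) *
        (2 * (η * (Gc * (κ * D) * (2 * S * √(H : ℝ))) * √(m : ℝ) / (1 - β))))) at hreg
  rw [DistributedControl.memory_bound_eq] at hreg
  -- Both the disagreement and the averaging errors are absorbed by `E₅`, using `16κ²` of the
  -- available `48κ²`; `E₃` only has to be nonnegative.
  have t3 : 0 ≤ DistributedControl.disagreementTerm m H T η Gc D d S β := by
    unfold DistributedControl.disagreementTerm; positivity
  have t4 := DistributedControl.gradient_bound_le (m := m) (H := H) (T := T) (Gc := Gc) (D := D)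
    (κ := κ) (S := S) hη hd
  have t5 := DistributedControl.consensus_bound_le (m := m) (H := H) (T := T) (Gc := Gc) (D := D)
    (κ := κ) (S := S) hη hd hm hβ0 hβ1
  have t4' : 0 ≤ DistributedControl.gradientTerm m H T η Gc D d S := by
    unfold DistributedControl.gradientTerm; positivity
  have t5' : 0 ≤ DistributedControl.consensusTerm m H T η Gc D d S β := by
    unfold DistributedControl.consensusTerm; positivity
  have t2 : (T : ℝ) * m * (Gc * (κ * D) * (2 * (κ * (2 * κ ^ 5 * ε' * W' /
        (γ - 2 * κ ^ 3 * ε) ^ 2 + 4 * κ ^ 8 * H ^ 2 * (κ + ε) * ε' * W' /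
          (ρ * (γ - 2 * κ ^ 3 * ε)) +
        (H + 1) * 2 * κ ^ 5 * ε' * W' / (ρ * (γ - 2 * κ ^ 3 * ε)) +
        (κ ^ 2 + H * (κ + ε) * 2 * κ ^ 5) / (γ - 2 * κ ^ 3 * ε) * (2 * ζ * ε)) +
      2 * κ ^ 3 * (2 * ζ * ε) / γ))) ≤
      48 * κ ^ 2 * DistributedControl.estimationTerm m H T Gc D κ γ ε ε' W' ζ := by
    unfold DistributedControl.estimationTerm
    rw [← hρ, show 2 * κ ^ 3 * (2 * ζ * ε) / γ = 4 * κ ^ 3 * ζ * ε / γ by ring]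
    set X := κ * (2 * κ ^ 5 * ε' * W' / (γ - 2 * κ ^ 3 * ε) ^ 2 +
        4 * κ ^ 8 * H ^ 2 * (κ + ε) * ε' * W' / (ρ * (γ - 2 * κ ^ 3 * ε)) +
        (H + 1) * 2 * κ ^ 5 * ε' * W' / (ρ * (γ - 2 * κ ^ 3 * ε)) +
        (κ ^ 2 + H * (κ + ε) * 2 * κ ^ 5) / (γ - 2 * κ ^ 3 * ε) * (2 * ζ * ε)) +
      4 * κ ^ 3 * ζ * ε / γ with hX
    have hX0 : 0 ≤ X := by positivity
    have h2 : 1 ≤ √(2 : ℝ) := Real.one_le_sqrt.2 (by norm_num)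
    calc (T : ℝ) * m * (Gc * (κ * D) * (2 * X)) = 2 * (κ * 1) * (m * T * Gc * D * 1 * X) := by ring
      _ ≤ 48 * (κ * κ) * (m * T * Gc * D * √2 * X) := by gcongr; norm_num
      _ = _ := by ring
  have t6 : (m : ℝ) * (16 * d₁ * κ ^ 6 / γ) / (2 * η) ≤
      (m * (16 * d₁ * κ ^ 6 / γ) / 2 + 1) * (1 / η) := by
    have : 0 < 1 / η := by positivity
    calc (m : ℝ) * (16 * d₁ * κ ^ 6 / γ) / (2 * η) =
          m * (16 * d₁ * κ ^ 6 / γ) / 2 * (1 / η) := by field_simp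
      _ ≤ _ := by gcongr; linarith
  have t1 : 48 * κ ^ 2 * DistributedControl.memoryTerm m H T η Gc D κ ε W' S β =
      48 * κ ^ 2 * (η * T * m * H ^ 3 * (Gc * D) ^ 2 * (κ + ε) * κ ^ 3 * W' *
        (S * √(m : ℝ) / (1 - β))) := rfl
  rw [t1]
  have hk2 : 0 ≤ κ ^ 2 := by positivity
  have t3' := mul_nonneg hk2 t3
  have t4'' := mul_nonneg hk2 t4'
  have t5'' := mul_nonneg hk2 t5'
  linarith
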